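/- Let $(\mathcal X,\mathscr X)$ be a measurable space, $Q$ a Markov transition kernel on $\mathcal X$, and $\mu$ a probability measure on $\mathcal X$ that is stationary for $Q$. Write $\mathbb E^Q[\,\cdot\mid X_t=x]$ for expectation of functions of $(x,X_{t+1})$ with $X_{t+1}\sim Q(x,\cdot)$, and $\mu\otimes Q$ for the joint law of $(X_t,X_{t+1})$ when $X_t\sim\mu$. For $s\ge 1$ let $E^{\phi_s}$ be the space of ($\mu$-a.e. equivalence classes of) measurable $f:\mathcal X\to\mathbb R$ with $\mathbb E^\mu[\exp(|f(X)/c|^s)]<\infty$ for all $c>0$, equipped with the norm $\|f\|_{\phi_s}=\inf\{c>0:\mathbb E^\mu[\exp(|f(X)/c|^s)]\le 2\}$ and the $\mu$-a.e. pointwise order. Let $\beta\in(0,1)$, $\alpha\in\mathbb R$ (for robust, risk-sensitive or unit-IES Epstein--Zin preferences $\alpha=-(\theta(1-\beta))^{-1}$ with $\theta>0$), and let $u:\mathcal X\times\mathcal X\to\mathbb R$ be measurable. Define $$\mathbb T f(x)=\beta\log \mathbb E^{Q}\left[\left. e^{f(X_{t+1})+\alpha u(X_t,X_{t+1})}\right|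 X_t=x\right].$$ For $v \in E^{\phi_1}$ let $$\mathbb D_v f(x)=\beta\,\mathbb E^Q\left[\left. m_v(X_t,X_{t+1})f(X_{t+1})\right|X_t=x\right],\qquad m_v(X_t,X_{t+1})=\frac{e^{v(X_{t+1})+\alpha u(X_t,X_{t+1})}}{\mathbb E^Q[e^{v(X_{t+1})+\alpha u(X_t,X_{t+1})}|X_t]}.$$ A fixed point $v$ of $\mathbb T$ in $E^{\phi_1}$ is called stable in $E^{\phi_1}$ if $\mathbb D_v$ is a bounded linear operator on $E^{\phi_1}$ with spectral radius $\lim_{n\to\infty}\|\mathbb D_v^n\|^{1/n}<1$. Theorem. Let $r\ge 1$ and suppose that $$\mathbb E^{\mu\otimes Q}\left[\exp(|u(X_t,X_{t+1})|^r/c)\right]<\infty\quad\text{for all } c>0.$$ Then $\mathbb T$ has a fixed point $v\in E^{\phi_r}$. Moreover, if $r>1$, then: (i) $v$ is the unique fixed point of $\mathbb T$ in $E^{\phi_s}$ for each $s\in(1,r]$; and (ii) $v$ is both the smallest fixed point of $\mathbb T$ in $E^{\phi_1}$ and the unique stable fixed point of $\mathbb T$ in $E^{\phi_1}$. -/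

import Mathlib

open MeasureTheory ProbabilityTheory Filter Topology

noncomputable section

/-! ### Exponential Orlicz hearts -/

section OrliczHeart

variable {𝒳 : Type*} [MeasurableSpace 𝒳]

/-- The exponential moment `E^μ[exp(|f(X)/c|^r)]`, with values in `[0, ∞]`. -/
def expMoment (μ : Measure 𝒳) (r c : ℝ) (f : 𝒳 → ℝ) : ENNReal :=
  ∫⁻ x, ENNReal.ofReal (Real.exp (|f x / c| ^ r)) ∂μ

theorem expMoment_congr {μ : Measure 𝒳} {r c : ℝ} {f g : 𝒳 → ℝ} (h : f =ᵐ[μ] g) :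
    expMoment μ r c f = expMoment μ r c g := by
  refine lintegral_congr_ae ?_
  filter_upwards [h] with x hx
  rw [hx]

theorem aemeasurable_expMoment {μ : Measure 𝒳} (r c : ℝ) (f : 𝒳 →ₘ[μ] ℝ) :
    AEMeasurable (fun x => ENNReal.ofReal (Real.exp (|f x / c| ^ r))) μ := by
  have hf : AEMeasurable f μ := f.aestronglyMeasurable.aemeasurable
  have h1 : AEMeasurable (fun x => |f x / c|) μ :=
    continuous_abs.measurable.comp_aemeasurable (hf.div_const c)
  exact (Real.measurable_exp.comp_aemeasurable (h1.pow_const r)).ennreal_ofReal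

theorem exp_abs_add_rpow_le {r a b : ℝ} (hr : 1 ≤ r) (ha : 0 < a) (hb : 0 < b) (x y : ℝ) :
    Real.exp (|(x + y) / (a + b)| ^ r) ≤
      a / (a + b) * Real.exp (|x / a| ^ r) + b / (a + b) * Real.exp (|y / b| ^ r) := by
  have hab : 0 < a + b := add_pos ha hb
  have hsum : a / (a + b) + b / (a + b) = 1 := by field_simp
  have h1 : |(x + y) / (a + b)| ≤ a / (a + b) * |x / a| + b / (a + b) * |y / b| := by
    have e1 : a / (a + b) * |x / a| = |x| / (a + b) := by
      rw [abs_div, abs_of_pos ha]; field_simp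
    have e2 : b / (a + b) * |y / b| = |y| / (a + b) := by
      rw [abs_div, abs_of_pos hb]; field_simp
    rw [e1, e2, abs_div, abs_of_pos hab, ← add_div]
    gcongr
    exact abs_add_le x y
  have h2 := (convexOn_rpow hr).2 (Set.mem_Ici.2 (abs_nonneg (x / a)))
    (Set.mem_Ici.2 (abs_nonneg (y / b))) (div_nonneg ha.le hab.le) (div_nonneg hb.le hab.le) hsum
  have h3 := convexOn_exp.2 (Set.mem_univ (|x / a| ^ r)) (Set.mem_univ (|y / b| ^ r))
    (div_nonneg ha.le hab.le) (div_nonneg hb.le hab.le) hsum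
  simp only [smul_eq_mul] at h2 h3
  refine le_trans (Real.exp_le_exp.2 ?_) h3
  exact le_trans (Real.rpow_le_rpow (abs_nonneg _) h1 (by linarith)) h2

theorem expMoment_add_le {μ : Measure 𝒳} {r a b : ℝ} (hr : 1 ≤ r) (ha : 0 < a) (hb : 0 < b)
    (f g : 𝒳 →ₘ[μ] ℝ) :
    expMoment μ r (a + b) (f + g : 𝒳 →ₘ[μ] ℝ) ≤
      ENNReal.ofReal (a / (a + b)) * expMoment μ r a f +
        ENNReal.ofReal (b / (a + b)) * expMoment μ r b g := by
  have hab : 0 < a + b := add_pos ha hb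
  rw [expMoment_congr (AEEqFun.coeFn_add f g)]
  unfold expMoment
  rw [← lintegral_const_mul'' _ (aemeasurable_expMoment r a f),
    ← lintegral_const_mul'' _ (aemeasurable_expMoment r b g),
    ← lintegral_add_left' ((aemeasurable_expMoment r a f).const_mul _)]
  refine lintegral_mono fun x => ?_
  rw [← ENNReal.ofReal_mul (div_nonneg ha.le hab.le), ← ENNReal.ofReal_mul
    (div_nonneg hb.le hab.le), ← ENNReal.ofReal_add (by positivity) (by positivity)]
  exact ENNReal.ofReal_le_ofReal (exp_abs_add_rpow_le hr ha hb _ _)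

theorem expMoment_smul {μ : Measure 𝒳} {r c : ℝ} (k : ℝ) (f : 𝒳 →ₘ[μ] ℝ) :
    expMoment μ r c (k • f : 𝒳 →ₘ[μ] ℝ) = expMoment μ r (c / |k|) f := by
  rw [expMoment_congr (AEEqFun.coeFn_smul k f)]
  unfold expMoment
  refine lintegral_congr fun x => ?_
  have : |(k • (f : 𝒳 → ℝ)) x / c| = |f x / (c / |k|)| := by
    simp only [Pi.smul_apply, smul_eq_mul, abs_div, abs_mul, abs_abs]
    rw [div_div_eq_mul_div, mul_comm]
  rw [this]

theorem expMoment_zero {μ : Measure 𝒳} [IsProbabilityMeasure μ] {r c : ℝ} (hr : 1 ≤ r) :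
    expMoment μ r c (0 : 𝒳 →ₘ[μ] ℝ) = 1 := by
  rw [expMoment_congr AEEqFun.coeFn_zero]
  simp [expMoment, Real.zero_rpow (by linarith : r ≠ 0)]

/-- The Orlicz heart `E^{φ_r}` of (`μ`-a.e. equal classes of) measurable functions `f` such that
`E^μ[exp(|f(X)/c|^r)] < ∞` for all `c > 0`. -/
def OrliczHeart (μ : Measure 𝒳) [IsProbabilityMeasure μ] (r : ℝ) (hr : 1 ≤ r) :
    Submodule ℝ (𝒳 →ₘ[μ] ℝ) where
  carrier := {f | ∀ c : ℝ, 0 < c → expMoment μ r c f < ⊤}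
  zero_mem' := by
    intro c _
    rw [expMoment_zero hr]
    exact ENNReal.one_lt_top
  add_mem' := by
    intro f g hf hg c hc
    have h := expMoment_add_le hr (half_pos hc) (half_pos hc) f g
    rw [add_halves] at h
    exact lt_of_le_of_lt h (ENNReal.add_lt_top.2
      ⟨ENNReal.mul_lt_top ENNReal.ofReal_lt_top (hf _ (half_pos hc)),
        ENNReal.mul_lt_top ENNReal.ofReal_lt_top (hg _ (half_pos hc))⟩)
  smul_mem' := by
    intro k f hf c hc
    rcases eq_or_ne k 0 with rfl | hk
    · rw [zero_smul, expMoment_zero hr]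
      exact ENNReal.one_lt_top
    · rw [expMoment_smul k]
      exact hf _ (div_pos hc (abs_pos.2 hk))

/-- The Luxemburg norm `‖f‖_{φ_r} = inf {c > 0 : E^μ[exp(|f(X)/c|^r)] ≤ 2}`. -/
def luxemburgNorm (μ : Measure 𝒳) (r : ℝ) (f : 𝒳 → ℝ) : ℝ :=
  sInf {c : ℝ | 0 < c ∧ expMoment μ r c f ≤ 2}

theorem luxemburg_bddBelow (μ : Measure 𝒳) (r : ℝ) (f : 𝒳 → ℝ) :
    BddBelow {c : ℝ | 0 < c ∧ expMoment μ r c f ≤ 2} :=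
  ⟨0, fun _ hc => hc.1.le⟩

theorem luxemburgNorm_nonneg (μ : Measure 𝒳) (r : ℝ) (f : 𝒳 → ℝ) : 0 ≤ luxemburgNorm μ r f :=
  Real.sInf_nonneg fun _ hc => hc.1.le

theorem luxemburg_nonempty {μ : Measure 𝒳} [IsProbabilityMeasure μ] {r : ℝ} {hr : 1 ≤ r}
    (f : OrliczHeart μ r hr) :
    {c : ℝ | 0 < c ∧ expMoment μ r c (f : 𝒳 →ₘ[μ] ℝ) ≤ 2}.Nonempty := by
  have hlim : Tendsto (fun n : ℕ => expMoment μ r ((n : ℝ) + 1) (f : 𝒳 →ₘ[μ] ℝ)) atTop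
      (𝓝 (∫⁻ _, ENNReal.ofReal (Real.exp 0) ∂μ)) := by
    refine tendsto_lintegral_of_dominated_convergence'
      (fun x => ENNReal.ofReal (Real.exp (|(f : 𝒳 →ₘ[μ] ℝ) x / 1| ^ r)))
      (fun n => aemeasurable_expMoment r _ _) (fun n => ?_) (f.2 1 one_pos).ne ?_
    · refine ae_of_all _ fun x => ENNReal.ofReal_le_ofReal (Real.exp_le_exp.2 ?_)
      refine Real.rpow_le_rpow (abs_nonneg _) ?_ (by linarith)
      rw [abs_div, abs_div, abs_of_pos (by positivity : (0 : ℝ) < (n : ℝ) + 1), abs_one]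
      exact div_le_div_of_nonneg_left (abs_nonneg _) one_pos (by simp)
    · refine ae_of_all _ fun x => ?_
      refine (ENNReal.continuous_ofReal.tendsto _).comp ((Real.continuous_exp.tendsto _).comp ?_)
      have h1 : Tendsto (fun n : ℕ => (f : 𝒳 →ₘ[μ] ℝ) x / ((n : ℝ) + 1)) atTop (𝓝 0) :=
        tendsto_const_nhds.div_atTop (tendsto_atTop_add_const_right _ _ tendsto_natCast_atTop_atTop)
      have h2 := (h1.abs).rpow_const (p := r) (Or.inr (by linarith))
      simpa [Real.zero_rpow (by linarith : r ≠ 0)] using h2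
  have h2 : (∫⁻ _, ENNReal.ofReal (Real.exp 0) ∂μ) < 2 := by simp
  obtain ⟨n, hn⟩ := (hlim.eventually_lt_const h2).exists
  exact ⟨(n : ℝ) + 1, by positivity, hn.le⟩

theorem luxemburgNorm_add_le {μ : Measure 𝒳} [IsProbabilityMeasure μ] {r : ℝ} {hr : 1 ≤ r}
    (f g : OrliczHeart μ r hr) :
    luxemburgNorm μ r ((f + g : OrliczHeart μ r hr) : 𝒳 →ₘ[μ] ℝ) ≤
      luxemburgNorm μ r (f : 𝒳 →ₘ[μ] ℝ) + luxemburgNorm μ r (g : 𝒳 →ₘ[μ] ℝ) := by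
  refine le_of_forall_pos_le_add fun ε hε => ?_
  obtain ⟨a, ⟨ha, ha2⟩, hal⟩ := Real.lt_sInf_add_pos (luxemburg_nonempty f) (half_pos hε)
  obtain ⟨b, ⟨hb, hb2⟩, hbl⟩ := Real.lt_sInf_add_pos (luxemburg_nonempty g) (half_pos hε)
  have hab : 0 < a + b := add_pos ha hb
  have key : expMoment μ r (a + b) ((f + g : OrliczHeart μ r hr) : 𝒳 →ₘ[μ] ℝ) ≤ 2 := by
    refine (expMoment_add_le hr ha hb (f : 𝒳 →ₘ[μ] ℝ) (g : 𝒳 →ₘ[μ] ℝ)).trans ?_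
    calc _ ≤ ENNReal.ofReal (a / (a + b)) * 2 + ENNReal.ofReal (b / (a + b)) * 2 := by gcongr
      _ = 2 := by
        rw [← add_mul, ← ENNReal.ofReal_add (by positivity) (by positivity), ← add_div,
          div_self hab.ne', ENNReal.ofReal_one, one_mul]
  have h := csInf_le (luxemburg_bddBelow μ r ((f + g : OrliczHeart μ r hr) : 𝒳 →ₘ[μ] ℝ))
    ⟨hab, key⟩
  unfold luxemburgNorm
  linarith

theorem luxemburgNorm_smul_le {μ : Measure 𝒳} [IsProbabilityMeasure μ] {r : ℝ} {hr : 1 ≤ r}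
    (k : ℝ) (f : OrliczHeart μ r hr) :
    luxemburgNorm μ r ((k • f : OrliczHeart μ r hr) : 𝒳 →ₘ[μ] ℝ) ≤
      |k| * luxemburgNorm μ r (f : 𝒳 →ₘ[μ] ℝ) := by
  rcases eq_or_ne k 0 with rfl | hk
  · refine le_of_forall_pos_le_add fun ε hε => ?_
    have h : expMoment μ r ε (((0 : ℝ) • f : OrliczHeart μ r hr) : 𝒳 →ₘ[μ] ℝ) ≤ 2 := by
      rw [zero_smul, Submodule.coe_zero, expMoment_zero hr]
      exact one_le_two
    have := csInf_le (luxemburg_bddBelow μ r _) ⟨hε, h⟩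
    simpa [luxemburgNorm] using this
  · have hk' : 0 < |k| := abs_pos.2 hk
    rw [← div_le_iff₀' hk']
    refine le_csInf (luxemburg_nonempty f) fun c hc => ?_
    rw [div_le_iff₀' hk']
    refine csInf_le (luxemburg_bddBelow μ r _) ⟨mul_pos hk' hc.1, ?_⟩
    rw [Submodule.coe_smul, expMoment_smul k, mul_div_cancel_left₀ _ hk'.ne']
    exact hc.2

theorem eq_zero_of_luxemburgNorm_eq_zero {μ : Measure 𝒳} [IsProbabilityMeasure μ] {r : ℝ}
    {hr : 1 ≤ r} (f : OrliczHeart μ r hr) (hf : luxemburgNorm μ r (f : 𝒳 →ₘ[μ] ℝ) = 0) :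
    f = 0 := by
  have hle : ∀ ε : ℝ, 0 < ε →
      ∫⁻ x, ENNReal.ofReal |(f : 𝒳 →ₘ[μ] ℝ) x| ∂μ ≤ ENNReal.ofReal ε * 2 := by
    intro ε hε
    obtain ⟨c, ⟨hc, hc2⟩, hcl⟩ := Real.lt_sInf_add_pos (luxemburg_nonempty f) hε
    have hcε : c ≤ ε := by
      unfold luxemburgNorm at hf
      linarith
    have hpt : ∀ t : ℝ, 0 ≤ t → t ≤ Real.exp (t ^ r) := by
      intro t ht
      rcases le_total t 1 with h | h
      · exact h.trans (Real.one_le_exp (Real.rpow_nonneg ht r))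
      · have h1 : t ≤ t ^ r := by
          simpa using Real.rpow_le_rpow_of_exponent_le h hr
        linarith [Real.add_one_le_exp (t ^ r)]
    calc ∫⁻ x, ENNReal.ofReal |(f : 𝒳 →ₘ[μ] ℝ) x| ∂μ
        ≤ ∫⁻ x, ENNReal.ofReal c *
            ENNReal.ofReal (Real.exp (|(f : 𝒳 →ₘ[μ] ℝ) x / c| ^ r)) ∂μ := by
          refine lintegral_mono fun x => ?_
          rw [← ENNReal.ofReal_mul hc.le]
          refine ENNReal.ofReal_le_ofReal ?_
          have h := mul_le_mul_of_nonneg_left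
            (hpt _ (abs_nonneg ((f : 𝒳 →ₘ[μ] ℝ) x / c))) hc.le
          have e : c * |(f : 𝒳 →ₘ[μ] ℝ) x / c| = |(f : 𝒳 →ₘ[μ] ℝ) x| := by
            rw [abs_div, abs_of_pos hc, mul_div_cancel₀ _ hc.ne']
          rwa [e] at h
      _ = ENNReal.ofReal c * expMoment μ r c (f : 𝒳 →ₘ[μ] ℝ) :=
          lintegral_const_mul'' _ (aemeasurable_expMoment r c _)
      _ ≤ ENNReal.ofReal ε * 2 := by gcongr
  have hzero : ∫⁻ x, ENNReal.ofReal |(f : 𝒳 →ₘ[μ] ℝ) x| ∂μ = 0 := by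
    refine le_antisymm (ge_of_tendsto (x := 𝓝[>] (0 : ℝ))
      (f := fun ε : ℝ => ENNReal.ofReal ε * 2) ?_ ?_) bot_le
    · have h1 : Tendsto (fun ε : ℝ => ENNReal.ofReal ε * 2) (𝓝 0) (𝓝 (ENNReal.ofReal 0 * 2)) :=
        ENNReal.Tendsto.mul_const (ENNReal.continuous_ofReal.tendsto 0) (Or.inr (by simp))
      simpa using h1.mono_left nhdsWithin_le_nhds
    · filter_upwards [self_mem_nhdsWithin] with ε hε using hle ε hε
  have hm : AEMeasurable (fun x => ENNReal.ofReal |(f : 𝒳 →ₘ[μ] ℝ) x|) μ :=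
    (continuous_abs.measurable.comp_aemeasurable
      (f : 𝒳 →ₘ[μ] ℝ).aestronglyMeasurable.aemeasurable).ennreal_ofReal
  rw [lintegral_eq_zero_iff' hm] at hzero
  refine Subtype.ext (AEEqFun.ext ?_)
  filter_upwards [hzero, AEEqFun.coeFn_zero (μ := μ) (β := ℝ)] with x hx h0
  rw [Submodule.coe_zero, h0]
  simpa using hx

theorem luxemburgNorm_zero {μ : Measure 𝒳} [IsProbabilityMeasure μ] {r : ℝ} (hr : 1 ≤ r) :
    luxemburgNorm μ r ((0 : OrliczHeart μ r hr) : 𝒳 →ₘ[μ] ℝ) = 0 :=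
  le_antisymm (by simpa using luxemburgNorm_smul_le (0 : ℝ) (0 : OrliczHeart μ r hr))
    (luxemburgNorm_nonneg _ _ _)

theorem luxemburgNorm_neg {μ : Measure 𝒳} [IsProbabilityMeasure μ] {r : ℝ} {hr : 1 ≤ r}
    (f : OrliczHeart μ r hr) :
    luxemburgNorm μ r ((-f : OrliczHeart μ r hr) : 𝒳 →ₘ[μ] ℝ) =
      luxemburgNorm μ r (f : 𝒳 →ₘ[μ] ℝ) := by
  have h : ∀ g : OrliczHeart μ r hr,
      luxemburgNorm μ r ((-g : OrliczHeart μ r hr) : 𝒳 →ₘ[μ] ℝ) ≤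
        luxemburgNorm μ r (g : 𝒳 →ₘ[μ] ℝ) := by
    intro g
    have := luxemburgNorm_smul_le (-1 : ℝ) g
    rwa [neg_one_smul ℝ g, abs_neg, abs_one, one_mul] at this
  refine le_antisymm (h f) ?_
  have := h (-f)
  rwa [neg_neg] at this

/-- `E^{φ_r}` is a normed group under the Luxemburg norm. -/
instance OrliczHeart.instNormedAddCommGroup (μ : Measure 𝒳) [IsProbabilityMeasure μ] (r : ℝ)
    (hr : 1 ≤ r) : NormedAddCommGroup (OrliczHeart μ r hr) :=
  AddGroupNorm.toNormedAddCommGroup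
    { toFun := fun f => luxemburgNorm μ r (f : 𝒳 →ₘ[μ] ℝ)
      map_zero' := luxemburgNorm_zero hr
      add_le' := luxemburgNorm_add_le
      neg' := luxemburgNorm_neg
      eq_zero_of_map_eq_zero' := eq_zero_of_luxemburgNorm_eq_zero }

/-- `E^{φ_r}` is a real normed space under the Luxemburg norm. -/
instance OrliczHeart.instNormedSpace (μ : Measure 𝒳) [IsProbabilityMeasure μ] (r : ℝ)
    (hr : 1 ≤ r) : NormedSpace ℝ (OrliczHeart μ r hr) where
  norm_smul_le k f := luxemburgNorm_smul_le k f

theorem OrliczHeart.norm_def {μ : Measure 𝒳} [IsProbabilityMeasure μ] {r : ℝ} {hr : 1 ≤ r}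
    (f : OrliczHeart μ r hr) : ‖f‖ = luxemburgNorm μ r (f : 𝒳 →ₘ[μ] ℝ) :=
  rfl

end OrliczHeart

/-! ### The recursion, its subgradient, and stability -/

section Recursion

variable {𝒳 : Type*} [MeasurableSpace 𝒳]

/-- The pointwise form of the recursion,
`f ↦ (x ↦ β log E^Q[exp(f(X') + α u(X, X')) | X = x])`. -/
def recursionFun (Q : Kernel 𝒳 𝒳) (β α : ℝ) (u : 𝒳 → 𝒳 → ℝ) (f : 𝒳 → ℝ) (x : 𝒳) : ℝ :=
  β * Real.log (∫ y, Real.exp (f y + α * u x y) ∂(Q x))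

/-- The change of measure
`m_v(x, y) = exp(v(y) + α u(x, y)) / E^Q[exp(v(X') + α u(X, X')) | X = x]`. -/
def changeOfMeasure (Q : Kernel 𝒳 𝒳) (α : ℝ) (u : 𝒳 → 𝒳 → ℝ) (v : 𝒳 → ℝ) (x y : 𝒳) : ℝ :=
  Real.exp (v y + α * u x y) / ∫ z, Real.exp (v z + α * u x z) ∂(Q x)

/-- The pointwise form of the subgradient,
`f ↦ (x ↦ β E^Q[m_v(X, X') f(X') | X = x])`. -/
def subgradientFun (Q : Kernel 𝒳 𝒳) (β α : ℝ) (u : 𝒳 → 𝒳 → ℝ) (v f : 𝒳 → ℝ) (x : 𝒳) : ℝ :=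
  β * ∫ y, changeOfMeasure Q α u v x y * f y ∂(Q x)

theorem measurable_exp_integrand {α : ℝ} {u : 𝒳 → 𝒳 → ℝ}
    (hu : Measurable (Function.uncurry u)) {f : 𝒳 → ℝ} (hf : Measurable f) :
    Measurable (fun p : 𝒳 × 𝒳 => Real.exp (f p.2 + α * u p.1 p.2)) :=
  Real.measurable_exp.comp ((hf.comp measurable_snd).add (hu.const_mul α))

theorem stronglyMeasurable_exp_integral (Q : Kernel 𝒳 𝒳) [IsMarkovKernel Q] {α : ℝ}
    {u : 𝒳 → 𝒳 → ℝ} (hu : Measurable (Function.uncurry u)) {f : 𝒳 → ℝ} (hf : Measurable f) :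
    StronglyMeasurable (fun x => ∫ y, Real.exp (f y + α * u x y) ∂(Q x)) :=
  (measurable_exp_integrand hu hf).stronglyMeasurable.integral_kernel_prod_right'

theorem measurable_recursionFun (Q : Kernel 𝒳 𝒳) [IsMarkovKernel Q] (β α : ℝ)
    {u : 𝒳 → 𝒳 → ℝ} (hu : Measurable (Function.uncurry u)) {f : 𝒳 → ℝ} (hf : Measurable f) :
    Measurable (recursionFun Q β α u f) :=
  (Real.measurable_log.comp (stronglyMeasurable_exp_integral Q hu hf).measurable).const_mul β

theorem measurable_subgradientFun (Q : Kernel 𝒳 𝒳) [IsMarkovKernel Q] (β α : ℝ)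
    {u : 𝒳 → 𝒳 → ℝ} (hu : Measurable (Function.uncurry u)) {v f : 𝒳 → ℝ} (hv : Measurable v)
    (hf : Measurable f) : Measurable (subgradientFun Q β α u v f) := by
  have h : Measurable (fun p : 𝒳 × 𝒳 => changeOfMeasure Q α u v p.1 p.2 * f p.2) :=
    ((measurable_exp_integrand hu hv).div
      ((stronglyMeasurable_exp_integral Q hu hv).measurable.comp measurable_fst)).mul
      (hf.comp measurable_snd)
  exact (h.stronglyMeasurable.integral_kernel_prod_right' (κ := Q)).measurable.const_mul β

/-- The operator `T` on `μ`-a.e. equal classes of measurable functions. If `μ` is invariant for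
`Q`, the class of `T f` does not depend on the representative of `f` (`recursionOp_mk`). -/
def recursionOp (μ : Measure 𝒳) (Q : Kernel 𝒳 𝒳) [IsMarkovKernel Q] (β α : ℝ)
    (u : 𝒳 → 𝒳 → ℝ) (hu : Measurable (Function.uncurry u)) (f : 𝒳 →ₘ[μ] ℝ) : 𝒳 →ₘ[μ] ℝ :=
  AEEqFun.mk (recursionFun Q β α u f)
    (measurable_recursionFun Q β α hu f.stronglyMeasurable.measurable).aestronglyMeasurable

/-- The subgradient `D_v` on `μ`-a.e. equal classes of measurable functions. If `μ` is invariant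
for `Q`, it does not depend on the representatives (`subgradientOp_mk`). -/
def subgradientOp (μ : Measure 𝒳) (Q : Kernel 𝒳 𝒳) [IsMarkovKernel Q] (β α : ℝ)
    (u : 𝒳 → 𝒳 → ℝ) (hu : Measurable (Function.uncurry u)) (v f : 𝒳 →ₘ[μ] ℝ) : 𝒳 →ₘ[μ] ℝ :=
  AEEqFun.mk (subgradientFun Q β α u v f)
    (measurable_subgradientFun Q β α hu v.stronglyMeasurable.measurable
      f.stronglyMeasurable.measurable).aestronglyMeasurable

theorem ae_ae_eq_of_invariant {μ : Measure 𝒳} {Q : Kernel 𝒳 𝒳} (hQ : Q.Invariant μ)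
    {f g : 𝒳 → ℝ} (h : f =ᵐ[μ] g) : ∀ᵐ x ∂μ, f =ᵐ[Q x] g := by
  have h' : f =ᵐ[μ.bind Q] g := by rwa [hQ.def]
  exact Measure.ae_ae_of_ae_comp h'

theorem recursionOp_mk {μ : Measure 𝒳} {Q : Kernel 𝒳 𝒳} [IsMarkovKernel Q]
    (hQ : Q.Invariant μ) (β α : ℝ) {u : 𝒳 → 𝒳 → ℝ} (hu : Measurable (Function.uncurry u))
    (f : 𝒳 → ℝ) (hf : AEStronglyMeasurable f μ) :
    recursionOp μ Q β α u hu (AEEqFun.mk f hf) =ᵐ[μ] recursionFun Q β α u f := by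
  refine (AEEqFun.coeFn_mk _ _).trans ?_
  filter_upwards [ae_ae_eq_of_invariant hQ (AEEqFun.coeFn_mk f hf)] with x hx
  unfold recursionFun
  congr 2
  refine integral_congr_ae ?_
  filter_upwards [hx] with y hy
  rw [hy]

theorem subgradientOp_mk {μ : Measure 𝒳} {Q : Kernel 𝒳 𝒳} [IsMarkovKernel Q]
    (hQ : Q.Invariant μ) (β α : ℝ) {u : 𝒳 → 𝒳 → ℝ} (hu : Measurable (Function.uncurry u))
    (v f : 𝒳 → ℝ) (hv : AEStronglyMeasurable v μ) (hf : AEStronglyMeasurable f μ) :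
    subgradientOp μ Q β α u hu (AEEqFun.mk v hv) (AEEqFun.mk f hf) =ᵐ[μ]
      subgradientFun Q β α u v f := by
  refine (AEEqFun.coeFn_mk _ _).trans ?_
  filter_upwards [ae_ae_eq_of_invariant hQ (AEEqFun.coeFn_mk f hf),
    ae_ae_eq_of_invariant hQ (AEEqFun.coeFn_mk v hv)] with x hx hx'
  unfold subgradientFun changeOfMeasure
  congr 1
  have e : (∫ z, Real.exp ((AEEqFun.mk v hv : 𝒳 →ₘ[μ] ℝ) z + α * u x z) ∂(Q x)) =
      ∫ z, Real.exp (v z + α * u x z) ∂(Q x) := by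
    refine integral_congr_ae ?_
    filter_upwards [hx'] with y hy
    rw [hy]
  rw [e]
  refine integral_congr_ae ?_
  filter_upwards [hx, hx'] with y hy hy'
  rw [hy, hy']

/-- `v` is stable in `E^{φ_r}`: `D_v` is a bounded linear operator on `E^{φ_r}` with spectral
radius `ρ(D_v; E^{φ_r}) = lim ‖D_v^n‖^{1/n} < 1`. -/
def StableIn (μ : Measure 𝒳) [IsProbabilityMeasure μ] (Q : Kernel 𝒳 𝒳) [IsMarkovKernel Q]
    (β α : ℝ) (u : 𝒳 → 𝒳 → ℝ) (hu : Measurable (Function.uncurry u)) (r : ℝ) (hr : 1 ≤ r)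
    (v : 𝒳 →ₘ[μ] ℝ) : Prop :=
  ∃ D : OrliczHeart μ r hr →L[ℝ] OrliczHeart μ r hr,
    (∀ f : OrliczHeart μ r hr, (D f : 𝒳 →ₘ[μ] ℝ) = subgradientOp μ Q β α u hu v f) ∧
    ∃ ρ : ℝ, ρ < 1 ∧ Tendsto (fun n : ℕ => ‖D ^ n‖ ^ (1 / (n : ℝ))) atTop (𝓝 ρ)

/-- The set of fixed points of `T` in `E^{φ_r}`. -/
def fixedPointsIn (μ : Measure 𝒳) [IsProbabilityMeasure μ] (Q : Kernel 𝒳 𝒳) [IsMarkovKernel Q]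
    (β α : ℝ) (u : 𝒳 → 𝒳 → ℝ) (hu : Measurable (Function.uncurry u)) (r : ℝ) (hr : 1 ≤ r) :
    Set (𝒳 →ₘ[μ] ℝ) :=
  {v | v ∈ OrliczHeart μ r hr ∧ recursionOp μ Q β α u hu v = v}

end Recursion

end

/-! Membership in `E^{φ_1}` means that all exponential moments are finite, and the tail condition on
`u` puts `u` in that class under `μ ⊗ Q`. Everything rests on one estimate. For `c β ≥ 1`, Jensen
gives `exp (c T f) ≤ E^Q exp (c β (f + α u))`. Splitting the exponent as a `β`, `1 - β` convex
combination and using stationarity then gives `E exp (c T f) ≤ β E exp (c f) + (1 - β) K`, with `K`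
depending only on `u`. Hence the moments of `T^n f` are eventually bounded independently of `f`.

Existence: let `U` be the operator with reward `|α u|`. It dominates `T`: `|f| ≤ g` implies `|T f| ≤
U g`. The iterates of `U` from `0` increase, and a version of the estimate for `exp (c f ^ r)`
bounds their moments, so their supremum `h` is a fixed point of `U` with all these moments finite.
Then `T` preserves the order interval `[-h, h]`, and `T^n h` decreases to a fixed point of `T`.

Uniqueness: `T` is monotone and convex. For fixed points `v`, `w` and small `θ`, write `w = θ g + (1
- θ) v`. Then `w ≤ θ T^n g + (1 - θ) v` for all `n`. Although `g` blows up as `θ → 0`, the limiting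
bound on the moments of `T^n g` does not, so `E (w - v)⁺ = O(θ)` and `w ≤ v`. By symmetry `E^{φ_1}`
contains only one fixed point (`le_of_fixedPoints`), so it is least there.

Stability: at a fixed point, `m_v = exp ℓ` where `ℓ` has all exponential moments. Jensen under this
density and a `θ`, `1 - θ` splitting with `β < θ < 1` give `‖D_v^n‖ ≤ C (β / θ)^n`, so the spectral
radius is below one. -/

noncomputable section

/-! ### Finite exponential moments -/

section ExpMoments

/-- All exponential moments of `f`, of either sign, are finite. -/
def HasExpMoments {Ω : Type*} [MeasurableSpace Ω] (ν : Measure Ω) (f : Ω → ℝ) : Prop :=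
  ∀ c : ℝ, Integrable (fun x => Real.exp (c * f x)) ν

variable {Ω : Type*} [MeasurableSpace Ω] {ν : Measure Ω} {f g : Ω → ℝ}

theorem HasExpMoments.integrable_exp (hf : HasExpMoments ν f) :
    Integrable (fun x => Real.exp (f x)) ν := by
  simpa using hf 1

theorem HasExpMoments.const_mul (hf : HasExpMoments ν f) (k : ℝ) :
    HasExpMoments ν (fun x => k * f x) := fun c => by
  simpa [mul_assoc] using hf (c * k)

theorem HasExpMoments.congr (hf : HasExpMoments ν f) (h : f =ᵐ[ν] g) : HasExpMoments ν g :=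
  fun c => (hf c).congr (by filter_upwards [h] with x hx; rw [hx])

theorem HasExpMoments.of_abs_le (hf : HasExpMoments ν f) (hg : Measurable g)
    (h : ∀ᵐ x ∂ν, |g x| ≤ |f x|) : HasExpMoments ν g := fun c => by
  refine ((hf c).add (hf (-c))).mono' (by fun_prop) ?_
  filter_upwards [h] with x hx
  rw [Real.norm_eq_abs, Real.abs_exp]
  have h1 : c * g x ≤ |c * f x| :=
    (le_abs_self _).trans (by rw [abs_mul, abs_mul]; gcongr)
  have h2 := Real.exp_pos (c * f x)
  have h3 := Real.exp_pos (-c * f x)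
  simp only [Pi.add_apply]
  rcases abs_cases (c * f x) with ⟨e, -⟩ | ⟨e, -⟩ <;> rw [e] at h1
  · linarith [Real.exp_le_exp.2 h1]
  · rw [← neg_mul] at h1
    linarith [Real.exp_le_exp.2 h1]

theorem HasExpMoments.abs (hf : HasExpMoments ν f) (hm : Measurable f) :
    HasExpMoments ν (fun x => |f x|) :=
  hf.of_abs_le (by fun_prop) (by simp)

theorem exp_convex_comb_le {θ : ℝ} (h0 : 0 ≤ θ) (h1 : θ ≤ 1) (a b : ℝ) :
    Real.exp (θ * a + (1 - θ) * b) ≤ θ * Real.exp a + (1 - θ) * Real.exp b := by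
  simpa using convexOn_exp.2 (Set.mem_univ a) (Set.mem_univ b) h0 (sub_nonneg.2 h1) (by ring)

theorem HasExpMoments.add (hf : HasExpMoments ν f) (hg : HasExpMoments ν g)
    (hmf : Measurable f) (hmg : Measurable g) : HasExpMoments ν (fun x => f x + g x) := fun c => by
  refine ((hf (2 * c)).add (hg (2 * c))).mono' (by fun_prop) (ae_of_all _ fun x => ?_)
  rw [Real.norm_eq_abs, Real.abs_exp]
  have h := exp_convex_comb_le (θ := 1 / 2) (by norm_num) (by norm_num) (2 * c * f x) (2 * c * g x)
  rw [show (1 / 2) * (2 * c * f x) + (1 - 1 / 2) * (2 * c * g x) = c * (f x + g x) by ring] at h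
  simp only [Pi.add_apply]
  linarith [Real.exp_pos (2 * c * f x), Real.exp_pos (2 * c * g x)]

theorem HasExpMoments.sub (hf : HasExpMoments ν f) (hg : HasExpMoments ν g)
    (hmf : Measurable f) (hmg : Measurable g) : HasExpMoments ν (fun x => f x - g x) := by
  simpa [sub_eq_add_neg] using hf.add (hg.const_mul (-1)) hmf (by fun_prop)

theorem HasExpMoments.integrable (hf : HasExpMoments ν f) (hm : Measurable f) :
    Integrable f ν := by
  refine ((hf 1).add (hf (-1))).mono' hm.aestronglyMeasurable (ae_of_all _ fun x => ?_)
  simp only [Pi.add_apply, Real.norm_eq_abs, one_mul, neg_one_mul]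
  refine abs_le.2 ⟨?_, ?_⟩ <;>
  linarith [Real.add_one_le_exp (f x), Real.add_one_le_exp (-f x), Real.exp_pos (f x),
    Real.exp_pos (-f x)]

theorem integrable_exp_of_lintegral_lt_top (hm : Measurable f)
    (h : ∫⁻ x, ENNReal.ofReal (Real.exp (f x)) ∂ν < ⊤) :
    Integrable (fun x => Real.exp (f x)) ν :=
  ⟨by fun_prop, by
    rwa [hasFiniteIntegral_iff_ofReal (ae_of_all _ fun _ => (Real.exp_pos _).le)]⟩

theorem lintegral_exp_lt_top (h : Integrable (fun x => Real.exp (f x)) ν) :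
    ∫⁻ x, ENNReal.ofReal (Real.exp (f x)) ∂ν < ⊤ :=
  (hasFiniteIntegral_iff_ofReal (ae_of_all _ fun _ => (Real.exp_pos _).le)).1 h.2

/-- A nonnegative function with arbitrarily large finite exponential moments has all of them. -/
theorem hasExpMoments_of_nonneg [IsFiniteMeasure ν] (hm : Measurable f) (h0 : ∀ᵐ x ∂ν, 0 ≤ f x)
    {c₀ : ℝ} (h : ∀ c, c₀ ≤ c → ∫⁻ x, ENNReal.ofReal (Real.exp (c * f x)) ∂ν < ⊤) :
    HasExpMoments ν f := fun c => by
  refine (integrable_exp_of_lintegral_lt_top (by fun_prop)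
    (h (max c c₀) (le_max_right _ _))).mono' (by fun_prop) ?_
  filter_upwards [h0] with x hx
  rw [Real.norm_eq_abs, Real.abs_exp]
  exact Real.exp_le_exp.2 (mul_le_mul_of_nonneg_right (le_max_left _ _) hx)

/-- Jensen's inequality for `t ↦ exp (ψ (log t))`, given a supporting line of `ψ` of slope at
least one at `log ∫ exp a`. -/
theorem ofReal_exp_log_integral_le [IsProbabilityMeasure ν] {a : Ω → ℝ} (ψ : ℝ → ℝ)
    (hψ : Measurable ψ) (ha : Measurable a) (hint : Integrable (fun y => Real.exp (a y)) ν)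
    {m : ℝ} (hm : 1 ≤ m)
    (hsupp : ∀ y, ψ (Real.log (∫ y, Real.exp (a y) ∂ν)) +
      m * (a y - Real.log (∫ y, Real.exp (a y) ∂ν)) ≤ ψ (a y)) :
    ENNReal.ofReal (Real.exp (ψ (Real.log (∫ y, Real.exp (a y) ∂ν)))) ≤
      ∫⁻ y, ENNReal.ofReal (Real.exp (ψ (a y))) ∂ν := by
  by_cases htop : ∫⁻ y, ENNReal.ofReal (Real.exp (ψ (a y))) ∂ν = ⊤
  · rw [htop]; exact le_top
  have hi : Integrable (fun y => Real.exp (ψ (a y))) ν :=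
    integrable_exp_of_lintegral_lt_top (by fun_prop) (lt_top_iff_ne_top.2 htop)
  rw [← ofReal_integral_eq_lintegral_ofReal hi (ae_of_all _ fun _ => (Real.exp_pos _).le)]
  refine ENNReal.ofReal_le_ofReal ?_
  set I := ∫ y, Real.exp (a y) ∂ν with hI
  have hIpos : 0 < I := integral_exp_pos hint
  have hpt : ∀ y, Real.exp (ψ (Real.log I)) * (1 + m * (Real.exp (a y) / I - 1)) ≤
      Real.exp (ψ (a y)) := by
    intro y
    refine le_trans ?_ (Real.exp_le_exp.2 (hsupp y))
    rw [Real.exp_add]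
    refine mul_le_mul_of_nonneg_left ?_ (Real.exp_pos _).le
    have e : Real.exp (a y) / I = Real.exp (a y - Real.log I) := by
      rw [Real.exp_sub, Real.exp_log hIpos]
    -- Bernoulli's inequality, where `m ≥ 1` enters: the resulting minorant is affine in `exp (a y)
    -- / I`, which has mean one.
    have h := one_add_mul_self_le_rpow_one_add
      (s := Real.exp (a y - Real.log I) - 1) (by linarith [Real.exp_pos (a y - Real.log I)]) hm
    rw [e, mul_comm m (a y - _), Real.exp_mul]
    simpa using h
  have hA : Integrable (fun y => Real.exp (a y) / I - 1) ν :=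
    (hint.div_const I).sub (integrable_const 1)
  have hB : Integrable (fun y => 1 + m * (Real.exp (a y) / I - 1)) ν :=
    (integrable_const 1).add (hA.const_mul m)
  refine le_trans (le_of_eq ?_) (integral_mono (hB.const_mul (Real.exp (ψ (Real.log I)))) hi hpt)
  rw [integral_const_mul, integral_add (integrable_const _) (hA.const_mul m), integral_const_mul,
    integral_sub (hint.div_const I) (integrable_const _), integral_div, ← hI, div_self hIpos.ne']
  simp

/-- Bernoulli's inequality at `y / x - 1`, rescaled by `x ^ r`. It supplies the supporting line for
the Jensen bound on `r`-th power moments. -/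
theorem rpow_supporting_line {r x y : ℝ} (hr : 1 ≤ r) (hx : 0 < x) (hy : 0 ≤ y) :
    x ^ r + r * x ^ (r - 1) * (y - x) ≤ y ^ r := by
  have h := one_add_mul_self_le_rpow_one_add (s := y / x - 1)
    (by linarith [div_nonneg hy hx.le]) hr
  rw [add_sub_cancel, Real.div_rpow hy hx.le, le_div_iff₀ (by positivity)] at h
  have e : x ^ r = x ^ (r - 1) * x := by
    rw [← Real.rpow_add_one hx.ne', sub_add_cancel]
  refine le_trans (le_of_eq ?_) h
  rw [e]
  field_simp

/-- Jensen's inequality for the exponential under the density `exp ℓ`. -/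
theorem ofReal_exp_integral_le {ℓ s : Ω → ℝ} (hℓ : Measurable ℓ)
    (hs : Measurable s) (hℓint : Integrable (fun y => Real.exp (ℓ y)) ν)
    (hone : ∫ y, Real.exp (ℓ y) ∂ν = 1)
    (hsint : Integrable (fun y => Real.exp (ℓ y) * s y) ν) :
    ENNReal.ofReal (Real.exp (∫ y, Real.exp (ℓ y) * s y ∂ν)) ≤
      ∫⁻ y, ENNReal.ofReal (Real.exp (ℓ y + s y)) ∂ν := by
  by_cases htop : ∫⁻ y, ENNReal.ofReal (Real.exp (ℓ y + s y)) ∂ν = ⊤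
  · rw [htop]; exact le_top
  have hi : Integrable (fun y => Real.exp (ℓ y + s y)) ν :=
    integrable_exp_of_lintegral_lt_top (by fun_prop) (lt_top_iff_ne_top.2 htop)
  rw [← ofReal_integral_eq_lintegral_ofReal hi (ae_of_all _ fun _ => (Real.exp_pos _).le)]
  refine ENNReal.ofReal_le_ofReal ?_
  set J := ∫ y, Real.exp (ℓ y) * s y ∂ν with hJ
  -- The tangent line of `exp` at `J`, weighted by the density `exp ℓ`.
  have hpt : ∀ y, Real.exp J * ((1 - J) * Real.exp (ℓ y) + Real.exp (ℓ y) * s y) ≤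
      Real.exp (ℓ y + s y) := by
    intro y
    have h := mul_le_mul_of_nonneg_left (Real.add_one_le_exp (s y - J))
      (mul_pos (Real.exp_pos J) (Real.exp_pos (ℓ y))).le
    rw [← Real.exp_add, ← Real.exp_add, show J + ℓ y + (s y - J) = ℓ y + s y by ring] at h
    refine le_trans (le_of_eq ?_) h
    rw [Real.exp_add]
    ring
  have h2 := integral_mono (μ := ν) (((hℓint.const_mul (1 - J)).add hsint).const_mul
    (Real.exp J)) hi hpt
  refine le_trans (le_of_eq ?_) h2
  simp only [Pi.add_apply]
  rw [integral_const_mul, integral_add (hℓint.const_mul _) hsint, integral_const_mul, hone, ← hJ]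
  ring

end ExpMoments

/-! ### Exponential moments under a Markov kernel -/

section KernelMoments

variable {𝒳 : Type*} [MeasurableSpace 𝒳] {μ : Measure 𝒳} [IsProbabilityMeasure μ]
  {Q : Kernel 𝒳 𝒳} [IsMarkovKernel Q]

theorem measurePreserving_snd_compProd (hQ : Q.Invariant μ) :
    MeasurePreserving Prod.snd (μ ⊗ₘ Q) μ :=
  ⟨measurable_snd, (Measure.snd_compProd μ Q).trans hQ.def⟩

theorem measurePreserving_fst_compProd : MeasurePreserving Prod.fst (μ ⊗ₘ Q) μ :=
  ⟨measurable_fst, Measure.fst_compProd μ Q⟩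

theorem HasExpMoments.comp_snd (hQ : Q.Invariant μ) {f : 𝒳 → ℝ} (hf : HasExpMoments μ f) :
    HasExpMoments (μ ⊗ₘ Q) (fun p => f p.2) := fun c =>
  (measurePreserving_snd_compProd hQ).integrable_comp_of_integrable (hf c)

theorem HasExpMoments.comp_fst {f : 𝒳 → ℝ} (hf : HasExpMoments μ f) :
    HasExpMoments (μ ⊗ₘ Q) (fun p => f p.1) := fun c =>
  measurePreserving_fst_compProd.integrable_comp_of_integrable (hf c)

/-- The null set must not depend on the exponent. The countably many functions `exp (n |F|)`
dominate all `exp (c F)`, so one null set suffices. -/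
theorem HasExpMoments.ae_kernel {F : 𝒳 × 𝒳 → ℝ} (hm : Measurable F)
    (hF : HasExpMoments (μ ⊗ₘ Q) F) : ∀ᵐ x ∂μ, HasExpMoments (Q x) (fun y => F (x, y)) := by
  have h : ∀ n : ℕ, ∀ᵐ x ∂μ, Integrable (fun y => Real.exp (n * |F (x, y)|)) (Q x) := fun n =>
    ((Measure.integrable_compProd_iff (by fun_prop)).1 (hF.abs hm n)).1
  filter_upwards [ae_all_iff.2 h] with x hx c
  obtain ⟨n, hn⟩ := exists_nat_ge |c|
  refine (hx n).mono' ((hm.comp measurable_prodMk_left).const_mul c).exp.aestronglyMeasurable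
    (ae_of_all _ fun y => ?_)
  rw [Real.norm_eq_abs, Real.abs_exp]
  refine Real.exp_le_exp.2 ((le_abs_self _).trans ?_)
  rw [abs_mul]
  gcongr

/-- Integrating a conditional Jensen bound and splitting the exponent by convexity. -/
theorem lintegral_exp_le_of_ae_le (hQ : Q.Invariant μ) {G A : 𝒳 → ℝ} {F B : 𝒳 × 𝒳 → ℝ}
    (hmF : Measurable F) (hmA : Measurable A) (hmB : Measurable B)
    {θ : ℝ} (h0 : 0 ≤ θ) (h1 : θ ≤ 1)
    (hG : ∀ᵐ x ∂μ, ENNReal.ofReal (Real.exp (G x)) ≤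
      ∫⁻ y, ENNReal.ofReal (Real.exp (F (x, y))) ∂(Q x))
    (hF : ∀ p, F p ≤ θ * A p.2 + (1 - θ) * B p) :
    ∫⁻ x, ENNReal.ofReal (Real.exp (G x)) ∂μ ≤
      ENNReal.ofReal θ * ∫⁻ x, ENNReal.ofReal (Real.exp (A x)) ∂μ +
        ENNReal.ofReal (1 - θ) * ∫⁻ p, ENNReal.ofReal (Real.exp (B p)) ∂(μ ⊗ₘ Q) := by
  have h1' : 0 ≤ 1 - θ := sub_nonneg.2 h1
  calc ∫⁻ x, ENNReal.ofReal (Real.exp (G x)) ∂μ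
      ≤ ∫⁻ x, ∫⁻ y, ENNReal.ofReal (Real.exp (F (x, y))) ∂(Q x) ∂μ := lintegral_mono_ae hG
    _ = ∫⁻ p, ENNReal.ofReal (Real.exp (F p)) ∂(μ ⊗ₘ Q) :=
        (Measure.lintegral_compProd
          (f := fun p => ENNReal.ofReal (Real.exp (F p))) (by fun_prop)).symm
    _ ≤ ∫⁻ p, (ENNReal.ofReal θ * ENNReal.ofReal (Real.exp (A p.2)) +
          ENNReal.ofReal (1 - θ) * ENNReal.ofReal (Real.exp (B p))) ∂(μ ⊗ₘ Q) := by
        refine lintegral_mono fun p => ?_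
        rw [← ENNReal.ofReal_mul h0, ← ENNReal.ofReal_mul h1',
          ← ENNReal.ofReal_add (by positivity) (by positivity)]
        exact ENNReal.ofReal_le_ofReal
          ((Real.exp_le_exp.2 (hF p)).trans (exp_convex_comb_le h0 h1 _ _))
    _ = _ := by
        rw [lintegral_add_left (by fun_prop), lintegral_const_mul _ (by fun_prop),
          lintegral_const_mul _ (by fun_prop),
          (measurePreserving_snd_compProd hQ).lintegral_comp
            (f := fun x => ENNReal.ofReal (Real.exp (A x))) (by fun_prop)]

end KernelMoments

/-! ### The recursion -/

section RecursionLemmas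

section

variable {𝒳 : Type*} [MeasurableSpace 𝒳] {μ : Measure 𝒳} {Q : Kernel 𝒳 𝒳} {u : 𝒳 → 𝒳 → ℝ}

theorem hasExpMoments_abs_reward (hu : Measurable (Function.uncurry u))
    (hum : HasExpMoments (μ ⊗ₘ Q) (Function.uncurry u)) (α : ℝ) :
    HasExpMoments (μ ⊗ₘ Q) (Function.uncurry fun x y => |α * u x y|) :=
  (hum.const_mul α).abs (hu.const_mul α)

theorem ae_ae_of_invariant (hQ : Q.Invariant μ) {p : 𝒳 → Prop} (h : ∀ᵐ x ∂μ, p x) :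
    ∀ᵐ x ∂μ, ∀ᵐ y ∂(Q x), p y := by
  have h' : ∀ᵐ x ∂(μ.bind Q), p x := by rwa [hQ.def]
  exact Measure.ae_ae_of_ae_comp h'

end

variable {𝒳 : Type*} [MeasurableSpace 𝒳] {μ : Measure 𝒳} [IsProbabilityMeasure μ]
  {Q : Kernel 𝒳 𝒳} [IsMarkovKernel Q] {β α : ℝ} {u : 𝒳 → 𝒳 → ℝ} {f g : 𝒳 → ℝ} {x : 𝒳}

theorem measurable_add_reward (hu : Measurable (Function.uncurry u)) (hf : Measurable f) (α : ℝ) :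
    Measurable (fun p : 𝒳 × 𝒳 => f p.2 + α * u p.1 p.2) :=
  (hf.comp measurable_snd).add (hu.const_mul α)

theorem measurable_add_reward_right (hu : Measurable (Function.uncurry u)) (hf : Measurable f)
    (α : ℝ) (x : 𝒳) : Measurable (fun y => f y + α * u x y) :=
  (measurable_add_reward hu hf α).comp measurable_prodMk_left

theorem measurable_abs_reward (hu : Measurable (Function.uncurry u)) (α : ℝ) :
    Measurable (Function.uncurry fun x y => |α * u x y|) :=
  continuous_abs.measurable.comp (hu.const_mul α)

theorem hasExpMoments_add_reward (hQ : Q.Invariant μ) (hu : Measurable (Function.uncurry u))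
    (hum : HasExpMoments (μ ⊗ₘ Q) (Function.uncurry u)) (hf : HasExpMoments μ f)
    (hm : Measurable f) (α : ℝ) :
    HasExpMoments (μ ⊗ₘ Q) (fun p => f p.2 + α * u p.1 p.2) :=
  (hf.comp_snd hQ).add (hum.const_mul α) (by fun_prop) (hu.const_mul α)

theorem ae_hasExpMoments_add_reward (hQ : Q.Invariant μ) (hu : Measurable (Function.uncurry u))
    (hum : HasExpMoments (μ ⊗ₘ Q) (Function.uncurry u)) (hf : HasExpMoments μ f)
    (hm : Measurable f) (α : ℝ) :
    ∀ᵐ x ∂μ, HasExpMoments (Q x) (fun y => f y + α * u x y) :=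
  (hasExpMoments_add_reward hQ hu hum hf hm α).ae_kernel (measurable_add_reward hu hm α)

theorem recursionFun_le (hβ : 0 ≤ β) (hu : Measurable (Function.uncurry u)) (hf : Measurable f)
    (hint : Integrable (fun y => Real.exp (g y + α * u x y)) (Q x))
    (h : ∀ᵐ y ∂(Q x), f y ≤ g y) : recursionFun Q β α u f x ≤ recursionFun Q β α u g x := by
  have hle : ∀ᵐ y ∂(Q x), Real.exp (f y + α * u x y) ≤ Real.exp (g y + α * u x y) := by
    filter_upwards [h] with y hy
    exact Real.exp_le_exp.2 (by linarith)
  have hint' : Integrable (fun y => Real.exp (f y + α * u x y)) (Q x) := by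
    refine hint.mono' (measurable_add_reward_right hu hf α x).exp.aestronglyMeasurable ?_
    filter_upwards [hle] with y hy
    rwa [Real.norm_eq_abs, Real.abs_exp]
  exact mul_le_mul_of_nonneg_left
    (Real.log_le_log (integral_exp_pos hint') (integral_mono_ae hint' hint hle)) hβ

theorem ae_recursionFun_le (hβ : 0 ≤ β) (hQ : Q.Invariant μ) (hu : Measurable (Function.uncurry u))
    (hum : HasExpMoments (μ ⊗ₘ Q) (Function.uncurry u)) (hf : Measurable f) (hg : Measurable g)
    (hgm : HasExpMoments μ g) (h : ∀ᵐ x ∂μ, f x ≤ g x) :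
    ∀ᵐ x ∂μ, recursionFun Q β α u f x ≤ recursionFun Q β α u g x := by
  filter_upwards [ae_ae_of_invariant hQ h, ae_hasExpMoments_add_reward hQ hu hum hgm hg α]
    with x h1 h2
  exact recursionFun_le hβ hu hf h2.integrable_exp h1

/-- The upper bound is monotonicity. The lower one is `log E exp (-Y) ≥ -log E exp Y`, which follows
from convexity of `t ↦ 1 / t`. -/
theorem abs_recursionFun_le (hβ : 0 ≤ β) (hu : Measurable (Function.uncurry u))
    (hf : Measurable f)
    (hint : Integrable (fun y => Real.exp (g y + 1 * |α * u x y|)) (Q x))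
    (h : ∀ᵐ y ∂(Q x), |f y| ≤ g y) :
    |recursionFun Q β α u f x| ≤ recursionFun Q β 1 (fun x y => |α * u x y|) g x := by
  unfold recursionFun
  rw [abs_mul, abs_of_nonneg hβ]
  refine mul_le_mul_of_nonneg_left ?_ hβ
  set I := ∫ y, Real.exp (g y + 1 * |α * u x y|) ∂(Q x) with hI
  have hIpos : 0 < I := integral_exp_pos hint
  have hab : ∀ᵐ y ∂(Q x), |f y + α * u x y| ≤ g y + 1 * |α * u x y| := by
    filter_upwards [h] with y hy
    linarith [abs_add_le (f y) (α * u x y)]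
  have hle : ∀ᵐ y ∂(Q x), Real.exp (f y + α * u x y) ≤ Real.exp (g y + 1 * |α * u x y|) := by
    filter_upwards [hab] with y hy
    exact Real.exp_le_exp.2 ((le_abs_self _).trans hy)
  have hint' : Integrable (fun y => Real.exp (f y + α * u x y)) (Q x) := by
    refine hint.mono' (measurable_add_reward_right hu hf α x).exp.aestronglyMeasurable ?_
    filter_upwards [hle] with y hy
    rwa [Real.norm_eq_abs, Real.abs_exp]
  -- Integrates the tangent line of `t ↦ 1 / t` at `I`, namely `2 / I - t / I ^ 2 ≤ 1 / t`, at `t =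
  -- exp (g + |α u|)`.
  have hlow : I⁻¹ ≤ ∫ y, Real.exp (f y + α * u x y) ∂(Q x) := by
    have hi2 : Integrable (fun y => 2 / I - Real.exp (g y + 1 * |α * u x y|) / I ^ 2) (Q x) :=
      (integrable_const _).sub (hint.div_const _)
    refine le_trans (le_of_eq ?_) (integral_mono_ae hi2 hint' ?_)
    · rw [integral_sub (integrable_const _) (hint.div_const _), integral_div (I ^ 2), ← hI]
      simp only [integral_const, probReal_univ, smul_eq_mul, one_mul]
      field_simp
      norm_num
    · filter_upwards [hab] with y hy
      have h1 : Real.exp (-(g y + 1 * |α * u x y|)) ≤ Real.exp (f y + α * u x y) :=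
        Real.exp_le_exp.2 (by linarith [neg_abs_le (f y + α * u x y)])
      refine le_trans ?_ h1
      rw [Real.exp_neg]
      set E := Real.exp (g y + 1 * |α * u x y|)
      have hE : 0 < E := Real.exp_pos _
      rw [div_sub_div _ _ hIpos.ne' (by positivity), inv_eq_one_div,
        div_le_div_iff₀ (by positivity) hE]
      nlinarith [mul_nonneg hIpos.le (sq_nonneg (I - E))]
  refine abs_le.2 ⟨?_, Real.log_le_log (integral_exp_pos hint') (integral_mono_ae hint' hint hle)⟩
  rw [← Real.log_inv]
  exact Real.log_le_log (by positivity) hlow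

theorem ae_abs_recursionFun_le (hβ : 0 ≤ β) (hQ : Q.Invariant μ)
    (hu : Measurable (Function.uncurry u)) (hum : HasExpMoments (μ ⊗ₘ Q) (Function.uncurry u))
    (hf : Measurable f) (hg : Measurable g) (hgm : HasExpMoments μ g)
    (h : ∀ᵐ x ∂μ, |f x| ≤ g x) :
    ∀ᵐ x ∂μ, |recursionFun Q β α u f x| ≤ recursionFun Q β 1 (fun x y => |α * u x y|) g x := by
  filter_upwards [ae_ae_of_invariant hQ h, ae_hasExpMoments_add_reward hQ
    (measurable_abs_reward hu α) (hasExpMoments_abs_reward hu hum α) hgm hg 1] with x h1 h2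
  exact abs_recursionFun_le hβ hu hf h2.integrable_exp h1

/-- Convexity of the cumulant functional, i.e. Hölder's inequality. Once the two exponentials are
normalised to mean one, it reduces to pointwise convexity of `exp`. -/
theorem recursionFun_convex_comb_le (hβ : 0 ≤ β) (hu : Measurable (Function.uncurry u))
    (hf : Measurable f) (hg : Measurable g) {θ : ℝ} (h0 : 0 ≤ θ) (h1 : θ ≤ 1)
    (hfi : Integrable (fun y => Real.exp (f y + α * u x y)) (Q x))
    (hgi : Integrable (fun y => Real.exp (g y + α * u x y)) (Q x)) :
    recursionFun Q β α u (fun y => θ * f y + (1 - θ) * g y) x ≤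
      θ * recursionFun Q β α u f x + (1 - θ) * recursionFun Q β α u g x := by
  unfold recursionFun
  set A := ∫ y, Real.exp (f y + α * u x y) ∂(Q x) with hA
  set B := ∫ y, Real.exp (g y + α * u x y) ∂(Q x) with hB
  have hApos : 0 < A := integral_exp_pos hfi
  have hBpos : 0 < B := integral_exp_pos hgi
  set L := θ * Real.log A + (1 - θ) * Real.log B with hL
  have hpt : ∀ y, Real.exp (θ * f y + (1 - θ) * g y + α * u x y) ≤
      Real.exp L * (θ * (Real.exp (f y + α * u x y) / A) +
        (1 - θ) * (Real.exp (g y + α * u x y) / B)) := by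
    intro y
    have h := mul_le_mul_of_nonneg_left (exp_convex_comb_le h0 h1 (f y + α * u x y - Real.log A)
      (g y + α * u x y - Real.log B)) (Real.exp_pos L).le
    rw [Real.exp_sub, Real.exp_sub, Real.exp_log hApos, Real.exp_log hBpos, ← Real.exp_add] at h
    refine le_trans (le_of_eq ?_) h
    congr 1
    rw [hL]
    ring
  have hi1 := (hfi.div_const A).const_mul θ
  have hi2 := (hgi.div_const B).const_mul (1 - θ)
  have hi : Integrable (fun y => Real.exp L * (θ * (Real.exp (f y + α * u x y) / A) +
        (1 - θ) * (Real.exp (g y + α * u x y) / B))) (Q x) := (hi1.add hi2).const_mul _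
  have hi0 : Integrable (fun y => Real.exp (θ * f y + (1 - θ) * g y + α * u x y)) (Q x) := by
    refine hi.mono' (measurable_add_reward_right hu
      (by fun_prop : Measurable fun y => θ * f y + (1 - θ) * g y) α x).exp.aestronglyMeasurable
      (ae_of_all _ fun y => ?_)
    rw [Real.norm_eq_abs, Real.abs_exp]
    exact hpt y
  have key : ∫ y, Real.exp (θ * f y + (1 - θ) * g y + α * u x y) ∂(Q x) ≤ Real.exp L := by
    refine (integral_mono hi0 hi hpt).trans (le_of_eq ?_)
    rw [integral_const_mul, integral_add hi1 hi2, integral_const_mul, integral_const_mul,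
      integral_div, integral_div, ← hA, ← hB, div_self hApos.ne', div_self hBpos.ne']
    ring
  have := mul_le_mul_of_nonneg_left
    ((Real.log_le_log (integral_exp_pos hi0) key).trans_eq (Real.log_exp L)) hβ
  linarith

/-- The recursion contracts large exponential moments up to a constant. -/
theorem lintegral_exp_recursionFun_le (hβ0 : 0 < β) (hβ1 : β < 1) (hQ : Q.Invariant μ)
    (hu : Measurable (Function.uncurry u)) (hum : HasExpMoments (μ ⊗ₘ Q) (Function.uncurry u))
    (hf : Measurable f) (hfm : HasExpMoments μ f) {c : ℝ} (hc : 1 ≤ c * β) :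
    ∫⁻ x, ENNReal.ofReal (Real.exp (c * recursionFun Q β α u f x)) ∂μ ≤
      ENNReal.ofReal β * ∫⁻ x, ENNReal.ofReal (Real.exp (c * f x)) ∂μ +
        ENNReal.ofReal (1 - β) *
          ∫⁻ p, ENNReal.ofReal (Real.exp (c * β * α / (1 - β) * u p.1 p.2)) ∂(μ ⊗ₘ Q) := by
  have hβ' : 1 - β ≠ 0 := by linarith
  have hm := measurable_add_reward hu hf α
  -- The Jensen function is `t ↦ c β t`, its own supporting line. The exponent splits as `c β (f + α
  -- u) = β (c f) + (1 - β) (c β α / (1 - β)) u`.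
  refine lintegral_exp_le_of_ae_le hQ (F := fun p => c * β * (f p.2 + α * u p.1 p.2))
    (hm.const_mul _) (hf.const_mul c) (hu.const_mul _) hβ0.le hβ1.le ?_ fun p => ?_
  · filter_upwards [ae_hasExpMoments_add_reward hQ hu hum hfm hf α] with x hx
    have h := ofReal_exp_log_integral_le (fun t => c * β * t) (by fun_prop)
      (measurable_add_reward_right hu hf α x) hx.integrable_exp hc (fun y => le_of_eq (by ring))
    simpa only [recursionFun, mul_assoc] using h
  · refine le_of_eq ?_
    simp only [Function.uncurry]
    field_simp

/-- The moment estimate covers only large positive exponents of `T f`. Domination of `|T f|` by the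
nonnegative `U |f|` yields the negative and small ones too. -/
theorem hasExpMoments_recursionFun (hβ0 : 0 < β) (hβ1 : β < 1) (hQ : Q.Invariant μ)
    (hu : Measurable (Function.uncurry u)) (hum : HasExpMoments (μ ⊗ₘ Q) (Function.uncurry u))
    (hf : Measurable f) (hfm : HasExpMoments μ f) :
    HasExpMoments μ (recursionFun Q β α u f) := by
  have hu' := measurable_abs_reward hu α
  have hum' := hasExpMoments_abs_reward hu hum α
  have hmU := measurable_recursionFun Q β 1 hu' (f := fun x => |f x|) (by fun_prop)
  have hab := ae_abs_recursionFun_le hβ0.le hQ hu hum (α := α) hf (by fun_prop) (hfm.abs hf)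
    (ae_of_all _ fun x => le_rfl)
  refine HasExpMoments.of_abs_le (f := recursionFun Q β 1 (fun x y => |α * u x y|)
    (fun x => |f x|)) ?_ (measurable_recursionFun Q β α hu hf)
    (hab.mono fun x hx => hx.trans (le_abs_self _))
  refine hasExpMoments_of_nonneg hmU (hab.mono fun x hx => (abs_nonneg _).trans hx) (c₀ := β⁻¹)
    fun c hc => ?_
  refine (lintegral_exp_recursionFun_le hβ0 hβ1 hQ hu' hum' (by fun_prop) (hfm.abs hf)
    (by rwa [inv_le_iff_one_le_mul₀ hβ0] at hc)).trans_lt ?_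
  exact ENNReal.add_lt_top.2
    ⟨ENNReal.mul_lt_top ENNReal.ofReal_lt_top (lintegral_exp_lt_top (hfm.abs hf c)),
      ENNReal.mul_lt_top ENNReal.ofReal_lt_top (lintegral_exp_lt_top (hum' _))⟩

/-- Continuity of the recursion along dominated almost everywhere convergence. -/
theorem tendsto_recursionFun (hQ : Q.Invariant μ)
    (hu : Measurable (Function.uncurry u)) (hum : HasExpMoments (μ ⊗ₘ Q) (Function.uncurry u))
    {F : ℕ → 𝒳 → ℝ} (hF : ∀ n, Measurable (F n)) (hf : Measurable f) (hg : Measurable g)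
    (hgm : HasExpMoments μ g) (hle : ∀ n, ∀ᵐ x ∂μ, |F n x| ≤ g x)
    (hlim : ∀ᵐ x ∂μ, Tendsto (fun n => F n x) atTop (𝓝 (f x))) :
    ∀ᵐ x ∂μ, Tendsto (fun n => recursionFun Q β α u (F n) x) atTop
      (𝓝 (recursionFun Q β α u f x)) := by
  filter_upwards [ae_ae_of_invariant hQ (ae_all_iff.2 hle), ae_ae_of_invariant hQ hlim,
    ae_hasExpMoments_add_reward hQ hu hum hgm hg α] with x h1 h2 h3
  have hi := h3.integrable_exp
  have hfg : ∀ᵐ y ∂(Q x), |f y| ≤ g y := by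
    filter_upwards [h1, h2] with y hy hy'
    exact le_of_tendsto' hy'.abs hy
  have hfi : Integrable (fun y => Real.exp (f y + α * u x y)) (Q x) := by
    refine hi.mono' (measurable_add_reward_right hu hf α x).exp.aestronglyMeasurable ?_
    filter_upwards [hfg] with y hy
    rw [Real.norm_eq_abs, Real.abs_exp]
    exact Real.exp_le_exp.2 (by linarith [le_abs_self (f y)])
  refine ((tendsto_integral_of_dominated_convergence _ (fun n =>
    (measurable_add_reward_right hu (hF n) α x).exp.aestronglyMeasurable) hi (fun n => ?_)
    ?_).log (integral_exp_pos hfi).ne').const_mul β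
  · filter_upwards [h1] with y hy
    rw [Real.norm_eq_abs, Real.abs_exp]
    exact Real.exp_le_exp.2 (by linarith [le_abs_self (F n y), hy n])
  · filter_upwards [h2] with y hy
    exact (Real.continuous_exp.tendsto _).comp (hy.add_const _)

end RecursionLemmas

/-! ### Uniqueness of fixed points with finite exponential moments -/

section Uniqueness

variable {𝒳 : Type*} [MeasurableSpace 𝒳] {μ : Measure 𝒳} [IsProbabilityMeasure μ]
  {Q : Kernel 𝒳 𝒳} [IsMarkovKernel Q] {β α : ℝ} {u : 𝒳 → 𝒳 → ℝ} {f g : 𝒳 → ℝ}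

theorem measurable_iterate_recursionFun (hu : Measurable (Function.uncurry u)) (hf : Measurable f)
    (n : ℕ) : Measurable ((recursionFun Q β α u)^[n] f) := by
  induction n with
  | zero => exact hf
  | succ n ih =>
    rw [Function.iterate_succ_apply']
    exact measurable_recursionFun Q β α hu ih

theorem hasExpMoments_iterate_recursionFun (hβ0 : 0 < β) (hβ1 : β < 1) (hQ : Q.Invariant μ)
    (hu : Measurable (Function.uncurry u)) (hum : HasExpMoments (μ ⊗ₘ Q) (Function.uncurry u))
    (hf : Measurable f) (hfm : HasExpMoments μ f) (n : ℕ) :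
    HasExpMoments μ ((recursionFun Q β α u)^[n] f) := by
  induction n with
  | zero => exact hfm
  | succ n ih =>
    rw [Function.iterate_succ_apply']
    exact hasExpMoments_recursionFun hβ0 hβ1 hQ hu hum
      (measurable_iterate_recursionFun hu hf n) ih

theorem affine_iterate_le {θ : ℝ} (h0 : 0 ≤ θ) (h1 : θ ≤ 1) {M K : ENNReal} {a : ℕ → ENNReal}
    (hM : a 0 ≤ M)
    (h : ∀ n, a (n + 1) ≤ ENNReal.ofReal θ * a n + ENNReal.ofReal (1 - θ) * K) (n : ℕ) :
    a n ≤ ENNReal.ofReal θ ^ n * M + K := by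
  induction n with
  | zero => simpa using le_add_right hM
  | succ n ih =>
    calc a (n + 1) ≤ ENNReal.ofReal θ * (ENNReal.ofReal θ ^ n * M + K) +
          ENNReal.ofReal (1 - θ) * K := (h n).trans (by gcongr)
      _ = ENNReal.ofReal θ ^ (n + 1) * M + (ENNReal.ofReal θ + ENNReal.ofReal (1 - θ)) * K := by
          ring
      _ = _ := by
          rw [← ENNReal.ofReal_add h0 (sub_nonneg.2 h1), add_sub_cancel, ENNReal.ofReal_one,
            one_mul]

/-- The starting function enters only through a term that vanishes as `n → ∞`; the remaining
constant does not see `f`. -/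
theorem lintegral_exp_iterate_recursionFun_le (hβ0 : 0 < β) (hβ1 : β < 1) (hQ : Q.Invariant μ)
    (hu : Measurable (Function.uncurry u)) (hum : HasExpMoments (μ ⊗ₘ Q) (Function.uncurry u))
    (hf : Measurable f) (hfm : HasExpMoments μ f) {c : ℝ} (hc : 1 ≤ c * β) (n : ℕ) :
    ∫⁻ x, ENNReal.ofReal (Real.exp (c * (recursionFun Q β α u)^[n] f x)) ∂μ ≤
      ENNReal.ofReal β ^ n * ∫⁻ x, ENNReal.ofReal (Real.exp (c * f x)) ∂μ +
        ∫⁻ p, ENNReal.ofReal (Real.exp (c * β * α / (1 - β) * u p.1 p.2)) ∂(μ ⊗ₘ Q) := by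
  refine affine_iterate_le (a := fun n =>
    ∫⁻ x, ENNReal.ofReal (Real.exp (c * (recursionFun Q β α u)^[n] f x)) ∂μ) hβ0.le hβ1.le
    le_rfl (fun n => ?_) n
  simp only [Function.iterate_succ_apply']
  exact lintegral_exp_recursionFun_le hβ0 hβ1 hQ hu hum (measurable_iterate_recursionFun hu hf n)
    (hasExpMoments_iterate_recursionFun hβ0 hβ1 hQ hu hum hf hfm n) hc

/-- If `w` is a convex combination of `g` and `v`, with `v` and `w` fixed, then it lies below the
same combination of the iterates of `g` and `v`. -/
theorem le_convex_comb_iterate (hβ0 : 0 < β) (hβ1 : β < 1) (hQ : Q.Invariant μ)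
    (hu : Measurable (Function.uncurry u)) (hum : HasExpMoments (μ ⊗ₘ Q) (Function.uncurry u))
    {v w : 𝒳 → ℝ} (hv : Measurable v) (hvm : HasExpMoments μ v) (hw : Measurable w)
    (hg : Measurable g) (hgm : HasExpMoments μ g)
    (hTv : recursionFun Q β α u v =ᵐ[μ] v) (hTw : recursionFun Q β α u w =ᵐ[μ] w)
    {θ : ℝ} (h0 : 0 ≤ θ) (h1 : θ ≤ 1) (h : ∀ᵐ x ∂μ, w x ≤ θ * g x + (1 - θ) * v x) (n : ℕ) :
    ∀ᵐ x ∂μ, w x ≤ θ * (recursionFun Q β α u)^[n] g x + (1 - θ) * v x := by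
  induction n with
  | zero => exact h
  | succ n ih =>
    have hm := measurable_iterate_recursionFun (Q := Q) (β := β) (α := α) hu hg n
    have hgn := hasExpMoments_iterate_recursionFun hβ0 hβ1 hQ hu hum hg hgm n (α := α)
    have hmono := ae_recursionFun_le hβ0.le hQ hu hum hw
      (by fun_prop : Measurable fun x => θ * (recursionFun Q β α u)^[n] g x + (1 - θ) * v x)
      ((hgn.const_mul θ).add (hvm.const_mul (1 - θ)) (by fun_prop) (by fun_prop)) ih (α := α)
    filter_upwards [hmono, hTv, hTw, ae_hasExpMoments_add_reward hQ hu hum hgn hm α,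
      ae_hasExpMoments_add_reward hQ hu hum hvm hv α] with x e1 e2 e3 e4 e5
    have h2 := recursionFun_convex_comb_le hβ0.le hu hm hv h0 h1 e4.integrable_exp
      e5.integrable_exp
    rw [e2] at h2
    rw [e3] at e1
    rw [Function.iterate_succ_apply']
    exact e1.trans h2

theorem le_of_fixedPoints (hβ0 : 0 < β) (hβ1 : β < 1) (hQ : Q.Invariant μ)
    (hu : Measurable (Function.uncurry u)) (hum : HasExpMoments (μ ⊗ₘ Q) (Function.uncurry u))
    {v w : 𝒳 → ℝ} (hv : Measurable v) (hvm : HasExpMoments μ v) (hw : Measurable w)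
    (hwm : HasExpMoments μ w)
    (hTv : recursionFun Q β α u v =ᵐ[μ] v) (hTw : recursionFun Q β α u w =ᵐ[μ] w) :
    ∀ᵐ x ∂μ, w x ≤ v x := by
  -- This exponent satisfies `c β ≥ 1`, as the moment bound requires, and `c ≥ 1`, so that `a ≤ exp
  -- (c a)`.
  set c := β⁻¹ with hc
  have hc1 : 1 ≤ c := by rw [hc]; exact (one_le_inv₀ hβ0).2 hβ1.le
  have hcβ : 1 ≤ c * β := by rw [hc, inv_mul_cancel₀ hβ0.ne']
  set K := ∫⁻ p, ENNReal.ofReal (Real.exp (c * β * α / (1 - β) * u p.1 p.2)) ∂(μ ⊗ₘ Q)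
  have hK : K < ⊤ := lintegral_exp_lt_top (hum _)
  set V := ∫⁻ x, ENNReal.ofReal |v x| ∂μ
  have hV : V < ⊤ := by
    have := (hvm.integrable hv).abs
    exact (hasFiniteIntegral_iff_ofReal (ae_of_all _ fun _ => abs_nonneg _)).1 this.2
  have hbound : ∀ N : ℕ, ∫⁻ x, ENNReal.ofReal (w x - v x) ∂μ ≤
      ENNReal.ofReal (1 / ((N : ℝ) + 1)) * (K + V) := by
    intro N
    have hN : (0 : ℝ) < (N : ℝ) + 1 := by positivity
    set θ : ℝ := 1 / ((N : ℝ) + 1) with hθ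
    have hθ0 : 0 < θ := by positivity
    have hθ1 : θ ≤ 1 := by rw [hθ, div_le_one hN]; simp
    -- Extrapolation of the segment from `v` through `w` by the factor `1 / θ`, so that `w = θ g +
    -- (1 - θ) v` exactly.
    set g : 𝒳 → ℝ := fun x => v x + ((N : ℝ) + 1) * (w x - v x) with hg
    have hgmeas : Measurable g := by fun_prop
    have hgm : HasExpMoments μ g :=
      hvm.add ((hwm.sub hvm hw hv).const_mul _) hv (by fun_prop)
    have hgn : ∀ n : ℕ, ∫⁻ x, ENNReal.ofReal (w x - v x) ∂μ ≤ ENNReal.ofReal θ *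
        (ENNReal.ofReal β ^ n * ∫⁻ x, ENNReal.ofReal (Real.exp (c * g x)) ∂μ + K + V) := by
      intro n
      have h1 := le_convex_comb_iterate hβ0 hβ1 hQ hu hum hv hvm hw hgmeas hgm hTv hTw hθ0.le hθ1
        (ae_of_all _ fun x => le_of_eq (by rw [hg, hθ]; field_simp; ring)) n
      have hm := measurable_iterate_recursionFun (Q := Q) (β := β) (α := α) hu hgmeas n
      calc ∫⁻ x, ENNReal.ofReal (w x - v x) ∂μ
          ≤ ∫⁻ x, ENNReal.ofReal θ *
              (ENNReal.ofReal (Real.exp (c * (recursionFun Q β α u)^[n] g x)) +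
                ENNReal.ofReal |v x|) ∂μ := by
            refine lintegral_mono_ae ?_
            filter_upwards [h1] with x hx
            rw [← ENNReal.ofReal_add (Real.exp_pos _).le (abs_nonneg _),
              ← ENNReal.ofReal_mul hθ0.le]
            refine ENNReal.ofReal_le_ofReal ?_
            set a := (recursionFun Q β α u)^[n] g x
            have ha : a ≤ Real.exp (c * a) := by
              rcases le_total a 0 with h | h
              · exact h.trans (Real.exp_pos _).le
              · nlinarith [Real.add_one_le_exp (c * a)]
            have := mul_le_mul_of_nonneg_left (add_le_add ha (neg_le_abs (v x))) hθ0.le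
            linarith
        _ = ENNReal.ofReal θ *
              (∫⁻ x, ENNReal.ofReal (Real.exp (c * (recursionFun Q β α u)^[n] g x)) ∂μ + V) := by
            rw [lintegral_const_mul _ (by fun_prop), lintegral_add_left (by fun_prop)]
        _ ≤ _ := by
            gcongr
            exact lintegral_exp_iterate_recursionFun_le hβ0 hβ1 hQ hu hum hgmeas hgm hcβ n
    -- Letting `n → ∞` before `N → ∞` removes the moment of `g`, the only quantity in the bound that
    -- may blow up with `N`.
    have hlim : Tendsto (fun n : ℕ => ENNReal.ofReal θ *
        (ENNReal.ofReal β ^ n * ∫⁻ x, ENNReal.ofReal (Real.exp (c * g x)) ∂μ + K + V)) atTop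
        (𝓝 (ENNReal.ofReal θ *
          (0 * ∫⁻ x, ENNReal.ofReal (Real.exp (c * g x)) ∂μ + K + V))) := by
      refine ENNReal.Tendsto.const_mul (((ENNReal.Tendsto.mul_const
        (ENNReal.tendsto_pow_atTop_nhds_zero_of_lt_one (by simpa using hβ1))
        (Or.inr (lintegral_exp_lt_top (hgm c)).ne)).add_const K).add_const V)
        (Or.inr ENNReal.ofReal_ne_top)
    rw [zero_mul, zero_add] at hlim
    exact ge_of_tendsto' hlim hgn
  have hlim0 : Tendsto (fun N : ℕ => ENNReal.ofReal (1 / ((N : ℝ) + 1)) * (K + V)) atTop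
      (𝓝 (ENNReal.ofReal 0 * (K + V))) :=
    ENNReal.Tendsto.mul_const ((ENNReal.continuous_ofReal.tendsto _).comp
      tendsto_one_div_add_atTop_nhds_zero_nat) (Or.inr (ENNReal.add_lt_top.2 ⟨hK, hV⟩).ne)
  have hzero : ∫⁻ x, ENNReal.ofReal (w x - v x) ∂μ = 0 := by
    have := ge_of_tendsto' hlim0 hbound
    simpa using this
  rw [lintegral_eq_zero_iff (by fun_prop)] at hzero
  filter_upwards [hzero] with x hx
  simpa using hx

end Uniqueness

/-! ### The subgradient at a fixed point -/

section Subgradient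

theorem expMoment_one_eq {𝒳 : Type*} [MeasurableSpace 𝒳] {μ : Measure 𝒳} {c : ℝ} (hc : 0 < c) (f : 𝒳 → ℝ) :
    expMoment μ 1 c f = ∫⁻ x, ENNReal.ofReal (Real.exp (c⁻¹ * |f x|)) ∂μ := by
  simp only [expMoment, Real.rpow_one, abs_div, abs_of_pos hc]
  simp only [div_eq_inv_mul]

theorem subgradientFun_congr_ae {𝒳 : Type*} [MeasurableSpace 𝒳] {μ : Measure 𝒳}
    {Q : Kernel 𝒳 𝒳} {β α : ℝ} {u : 𝒳 → 𝒳 → ℝ} {v f g : 𝒳 → ℝ} (hQ : Q.Invariant μ) (h : f =ᵐ[μ] g) :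
    subgradientFun Q β α u v f =ᵐ[μ] subgradientFun Q β α u v g := by
  filter_upwards [ae_ae_eq_of_invariant hQ h] with x hx
  unfold subgradientFun
  congr 1
  refine integral_congr_ae ?_
  filter_upwards [hx] with y hy
  rw [hy]

variable {𝒳 : Type*} [MeasurableSpace 𝒳] {μ : Measure 𝒳} [IsProbabilityMeasure μ]
  {Q : Kernel 𝒳 𝒳} [IsMarkovKernel Q] {β α : ℝ} {u : 𝒳 → 𝒳 → ℝ} {v f g : 𝒳 → ℝ}

/-- The logarithm of the change of measure at a fixed point `v` of the recursion. -/
def logDensity (β α : ℝ) (u : 𝒳 → 𝒳 → ℝ) (v : 𝒳 → ℝ) (p : 𝒳 × 𝒳) : ℝ :=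
  v p.2 + α * u p.1 p.2 - v p.1 / β

theorem measurable_logDensity (hu : Measurable (Function.uncurry u)) (hv : Measurable v) :
    Measurable (logDensity β α u v) :=
  (measurable_add_reward hu hv α).sub ((hv.comp measurable_fst).div_const β)

theorem hasExpMoments_logDensity (hQ : Q.Invariant μ) (hu : Measurable (Function.uncurry u))
    (hum : HasExpMoments (μ ⊗ₘ Q) (Function.uncurry u)) (hv : Measurable v)
    (hvm : HasExpMoments μ v) : HasExpMoments (μ ⊗ₘ Q) (logDensity β α u v) := by
  have h := (hasExpMoments_add_reward hQ hu hum hvm hv α).sub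
    (hvm.comp_fst (Q := Q) |>.const_mul β⁻¹) (measurable_add_reward hu hv α) (by fun_prop)
  refine h.congr (ae_of_all _ fun p => ?_)
  simp only [logDensity]
  ring

/-- The fixed-point equation identifies the normalising integral of `m_v` with `exp (v x / β)`. -/
theorem changeOfMeasure_eq_exp_logDensity (hβ : 0 < β) (hQ : Q.Invariant μ)
    (hu : Measurable (Function.uncurry u)) (hum : HasExpMoments (μ ⊗ₘ Q) (Function.uncurry u))
    (hv : Measurable v) (hvm : HasExpMoments μ v) (hTv : recursionFun Q β α u v =ᵐ[μ] v) :
    ∀ᵐ x ∂μ, (∀ y, changeOfMeasure Q α u v x y = Real.exp (logDensity β α u v (x, y))) ∧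
      ∫ y, Real.exp (logDensity β α u v (x, y)) ∂(Q x) = 1 := by
  filter_upwards [hTv, ae_hasExpMoments_add_reward hQ hu hum hvm hv α] with x h1 h2
  have hpos : 0 < ∫ y, Real.exp (v y + α * u x y) ∂(Q x) := integral_exp_pos h2.integrable_exp
  have e : Real.exp (v x / β) = ∫ y, Real.exp (v y + α * u x y) ∂(Q x) := by
    rw [← h1, recursionFun, mul_div_cancel_left₀ _ hβ.ne', Real.exp_log hpos]
  have e2 : ∀ y, Real.exp (logDensity β α u v (x, y)) =
      Real.exp (v y + α * u x y) / Real.exp (v x / β) := fun y => by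
    simp only [logDensity, Real.exp_sub]
  refine ⟨fun y => by rw [changeOfMeasure, e2, e], ?_⟩
  simp only [e2]
  rw [integral_div, e, div_self hpos.ne']

theorem ae_integrable_exp_logDensity_mul (hQ : Q.Invariant μ)
    (hu : Measurable (Function.uncurry u)) (hum : HasExpMoments (μ ⊗ₘ Q) (Function.uncurry u))
    (hv : Measurable v) (hvm : HasExpMoments μ v) (hg : Measurable g) (hgm : HasExpMoments μ g) :
    ∀ᵐ x ∂μ, Integrable (fun y => Real.exp (logDensity β α u v (x, y)) * g y) (Q x) := by
  have hℓ := measurable_logDensity (β := β) (α := α) hu hv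
  have hℓm := hasExpMoments_logDensity (β := β) (α := α) hQ hu hum hv hvm
  have hg2 : Measurable (fun p : 𝒳 × 𝒳 => g p.2) := by fun_prop
  filter_upwards [(hℓm.add (hgm.comp_snd hQ) hℓ hg2).ae_kernel (by fun_prop),
    (hℓm.sub (hgm.comp_snd hQ) hℓ hg2).ae_kernel (by fun_prop)] with x h1 h2
  refine (h1.integrable_exp.add h2.integrable_exp).mono'
    ((hℓ.comp measurable_prodMk_left).exp.mul hg).aestronglyMeasurable (ae_of_all _ fun y => ?_)
  simp only [Pi.add_apply]
  rw [Real.norm_eq_abs, abs_mul, Real.abs_exp, sub_eq_add_neg, Real.exp_add, Real.exp_add,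
    ← mul_add]
  refine mul_le_mul_of_nonneg_left (abs_le.2 ⟨?_, ?_⟩) (Real.exp_pos _).le <;>
  linarith [Real.add_one_le_exp (g y), Real.add_one_le_exp (-g y), Real.exp_pos (g y),
    Real.exp_pos (-g y)]

theorem ae_integrable_changeOfMeasure_mul (hβ : 0 < β) (hQ : Q.Invariant μ)
    (hu : Measurable (Function.uncurry u)) (hum : HasExpMoments (μ ⊗ₘ Q) (Function.uncurry u))
    (hv : Measurable v) (hvm : HasExpMoments μ v) (hTv : recursionFun Q β α u v =ᵐ[μ] v)
    (hg : Measurable g) (hgm : HasExpMoments μ g) :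
    ∀ᵐ x ∂μ, Integrable (fun y => changeOfMeasure Q α u v x y * g y) (Q x) := by
  filter_upwards [changeOfMeasure_eq_exp_logDensity hβ hQ hu hum hv hvm hTv,
    ae_integrable_exp_logDensity_mul (β := β) (α := α) hQ hu hum hv hvm hg hgm] with x h1 h2
  simpa only [h1.1] using h2

/-- At a fixed point, the subgradient contracts exponential moments up to a constant. -/
theorem lintegral_exp_subgradientFun_le (hβ : 0 < β) (hQ : Q.Invariant μ)
    (hu : Measurable (Function.uncurry u)) (hum : HasExpMoments (μ ⊗ₘ Q) (Function.uncurry u))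
    (hv : Measurable v) (hvm : HasExpMoments μ v) (hTv : recursionFun Q β α u v =ᵐ[μ] v)
    (hg : Measurable g) (hgm : HasExpMoments μ g) {θ : ℝ} (h0 : 0 < θ) (h1 : θ < 1) {c : ℝ}
    (hc : 0 ≤ c) :
    ∫⁻ x, ENNReal.ofReal (Real.exp (c * |subgradientFun Q β α u v g x|)) ∂μ ≤
      ENNReal.ofReal θ * ∫⁻ x, ENNReal.ofReal (Real.exp (c * (β / θ) * |g x|)) ∂μ +
        ENNReal.ofReal (1 - θ) *
          ∫⁻ p, ENNReal.ofReal (Real.exp ((1 - θ)⁻¹ * logDensity β α u v p)) ∂(μ ⊗ₘ Q) := by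
  have hℓ := measurable_logDensity (β := β) (α := α) hu hv
  have h1' : 1 - θ ≠ 0 := by linarith
  refine lintegral_exp_le_of_ae_le hQ (F := fun p => logDensity β α u v p + c * β * |g p.2|)
    (by fun_prop) (by fun_prop) (by fun_prop) h0.le h1.le ?_ fun p => le_of_eq ?_
  · filter_upwards [changeOfMeasure_eq_exp_logDensity hβ hQ hu hum hv hvm hTv,
      ae_integrable_exp_logDensity_mul (β := β) (α := α) hQ hu hum hv hvm
        (by fun_prop : Measurable fun x => c * β * |g x|) ((hgm.abs hg).const_mul _)] with x hx hi
    -- A non-integrable function has integral `0` by convention, so the value `1` forces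
    -- integrability.
    have hℓint : Integrable (fun y => Real.exp (logDensity β α u v (x, y))) (Q x) :=
      Integrable.of_integral_ne_zero (by rw [hx.2]; exact one_ne_zero)
    refine le_trans (ENNReal.ofReal_le_ofReal (Real.exp_le_exp.2 ?_)) (ofReal_exp_integral_le
      (hℓ.comp measurable_prodMk_left) (by fun_prop) hℓint hx.2 hi)
    have e : (fun y => Real.exp (logDensity β α u v (x, y)) * (c * β * |g y|)) =
        fun y => c * β * |changeOfMeasure Q α u v x y * g y| := by
      funext y
      rw [hx.1, abs_mul, Real.abs_exp]
      ring
    rw [e, integral_const_mul, subgradientFun, abs_mul, abs_of_pos hβ, ← mul_assoc]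
    exact mul_le_mul_of_nonneg_left abs_integral_le_integral_abs (by positivity)
  -- The splitting is `ℓ + c β |g| = θ (c (β / θ) |g|) + (1 - θ) ((1 - θ)⁻¹ ℓ)`.
  · field_simp
    ring

theorem hasExpMoments_subgradientFun (hβ : 0 < β) (hQ : Q.Invariant μ)
    (hu : Measurable (Function.uncurry u)) (hum : HasExpMoments (μ ⊗ₘ Q) (Function.uncurry u))
    (hv : Measurable v) (hvm : HasExpMoments μ v) (hTv : recursionFun Q β α u v =ᵐ[μ] v)
    (hg : Measurable g) (hgm : HasExpMoments μ g) :
    HasExpMoments μ (subgradientFun Q β α u v g) := by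
  have hm := measurable_subgradientFun Q β α hu hv hg
  refine HasExpMoments.of_abs_le (f := fun x => |subgradientFun Q β α u v g x|) ?_ hm (by simp)
  refine hasExpMoments_of_nonneg (by fun_prop) (by simp) (c₀ := 0) fun c hc => ?_
  refine (lintegral_exp_subgradientFun_le hβ hQ hu hum hv hvm hTv hg hgm
    (θ := 1 / 2) (by norm_num) (by norm_num) hc).trans_lt ?_
  exact ENNReal.add_lt_top.2
    ⟨ENNReal.mul_lt_top ENNReal.ofReal_lt_top (lintegral_exp_lt_top (hgm.abs hg _)),
      ENNReal.mul_lt_top ENNReal.ofReal_lt_top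
        (lintegral_exp_lt_top (hasExpMoments_logDensity hQ hu hum hv hvm _))⟩

theorem measurable_iterate_subgradientFun (hu : Measurable (Function.uncurry u))
    (hv : Measurable v) (hf : Measurable f) (n : ℕ) :
    Measurable ((subgradientFun Q β α u v)^[n] f) := by
  induction n with
  | zero => exact hf
  | succ n ih =>
    rw [Function.iterate_succ_apply']
    exact measurable_subgradientFun Q β α hu hv ih

theorem hasExpMoments_iterate_subgradientFun (hβ : 0 < β) (hQ : Q.Invariant μ)
    (hu : Measurable (Function.uncurry u)) (hum : HasExpMoments (μ ⊗ₘ Q) (Function.uncurry u))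
    (hv : Measurable v) (hvm : HasExpMoments μ v) (hTv : recursionFun Q β α u v =ᵐ[μ] v)
    (hf : Measurable f) (hfm : HasExpMoments μ f) (n : ℕ) :
    HasExpMoments μ ((subgradientFun Q β α u v)^[n] f) := by
  induction n with
  | zero => exact hfm
  | succ n ih =>
    rw [Function.iterate_succ_apply']
    exact hasExpMoments_subgradientFun hβ hQ hu hum hv hvm hTv
      (measurable_iterate_subgradientFun hu hv hf n) ih

theorem lintegral_exp_iterate_subgradientFun_le (hβ : 0 < β) (hQ : Q.Invariant μ)
    (hu : Measurable (Function.uncurry u)) (hum : HasExpMoments (μ ⊗ₘ Q) (Function.uncurry u))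
    (hv : Measurable v) (hvm : HasExpMoments μ v) (hTv : recursionFun Q β α u v =ᵐ[μ] v)
    (hf : Measurable f) (hfm : HasExpMoments μ f) {θ : ℝ} (h0 : 0 < θ) (h1 : θ < 1) (n : ℕ)
    {c : ℝ} (hc : 0 ≤ c) :
    ∫⁻ x, ENNReal.ofReal (Real.exp (c * |(subgradientFun Q β α u v)^[n] f x|)) ∂μ ≤
      ∫⁻ x, ENNReal.ofReal (Real.exp (c * (β / θ) ^ n * |f x|)) ∂μ +
        ∫⁻ p, ENNReal.ofReal (Real.exp ((1 - θ)⁻¹ * logDensity β α u v p)) ∂(μ ⊗ₘ Q) := by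
  induction n generalizing c with
  | zero => simp
  | succ n ih =>
    set K := ∫⁻ p, ENNReal.ofReal (Real.exp ((1 - θ)⁻¹ * logDensity β α u v p)) ∂(μ ⊗ₘ Q)
    set A := ∫⁻ x, ENNReal.ofReal (Real.exp (c * (β / θ) ^ (n + 1) * |f x|)) ∂μ with hA
    -- Each application of the subgradient multiplies the exponent by `β / θ`, hence the induction
    -- over all `c` at once. The constant `K` does not accumulate, since its weights sum to at most
    -- one.
    have ih' := ih (c := c * (β / θ)) (by positivity)
    rw [mul_assoc c, ← pow_succ', ← hA] at ih'
    rw [Function.iterate_succ_apply']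
    calc _ ≤ ENNReal.ofReal θ * (A + K) + ENNReal.ofReal (1 - θ) * K :=
          (lintegral_exp_subgradientFun_le hβ hQ hu hum hv hvm hTv
            (measurable_iterate_subgradientFun hu hv hf n)
            (hasExpMoments_iterate_subgradientFun hβ hQ hu hum hv hvm hTv hf hfm n) h0 h1
            hc).trans (by gcongr)
      _ = ENNReal.ofReal θ * A + (ENNReal.ofReal θ + ENNReal.ofReal (1 - θ)) * K := by ring
      _ ≤ 1 * A + 1 * K := by
          rw [← ENNReal.ofReal_add h0.le (sub_nonneg.2 h1.le), add_sub_cancel, ENNReal.ofReal_one]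
          gcongr
          simpa using h1.le
      _ = A + K := by rw [one_mul, one_mul]

/-- The Luxemburg gauge of the iterated subgradient decays geometrically. -/
theorem exists_expMoment_iterate_subgradientFun_le (hβ : 0 < β) (hQ : Q.Invariant μ)
    (hu : Measurable (Function.uncurry u)) (hum : HasExpMoments (μ ⊗ₘ Q) (Function.uncurry u))
    (hv : Measurable v) (hvm : HasExpMoments μ v) (hTv : recursionFun Q β α u v =ᵐ[μ] v)
    {θ : ℝ} (h0 : 0 < θ) (h1 : θ < 1) :
    ∃ C : ℝ, 0 < C ∧ ∀ (n : ℕ) (f : 𝒳 → ℝ), Measurable f → HasExpMoments μ f → ∀ c : ℝ, 0 < c →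
      expMoment μ 1 c f ≤ 2 →
        expMoment μ 1 (C * (β / θ) ^ n * c) ((subgradientFun Q β α u v)^[n] f) ≤ 2 := by
  set K := ∫⁻ p, ENNReal.ofReal (Real.exp ((1 - θ)⁻¹ * logDensity β α u v p)) ∂(μ ⊗ₘ Q) with hK
  have hKtop : K < ⊤ := lintegral_exp_lt_top (hasExpMoments_logDensity hQ hu hum hv hvm _)
  -- Enlarging the gauge by `C` brings the moment bound `2 + K` down to `2`: by convexity it becomes
  -- `C⁻¹ (2 + K) + (1 - C⁻¹)`, which equals `2` for this `C`.
  set C := K.toReal + 1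
  have hCpos : 0 < C := by positivity
  have hC1 : 1 ≤ C := le_add_of_nonneg_left ENNReal.toReal_nonneg
  refine ⟨C, hCpos, fun n f hf hfm c hc hle => ?_⟩
  have hγ : 0 < (β / θ) ^ n := by positivity
  have hm := measurable_iterate_subgradientFun (Q := Q) (β := β) (α := α) hu hv hf n
  have hb := lintegral_exp_iterate_subgradientFun_le hβ hQ hu hum hv hvm hTv hf hfm h0 h1 n
    (c := ((β / θ) ^ n * c)⁻¹) (by positivity)
  rw [mul_inv, mul_comm ((β / θ) ^ n)⁻¹, inv_mul_cancel_right₀ hγ.ne', ← expMoment_one_eq hc,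
    ← hK] at hb
  replace hb := hb.trans (add_le_add_left hle K)
  rw [expMoment_one_eq (by positivity)]
  have hinv0 : 0 ≤ C⁻¹ := by positivity
  have hinv1 : C⁻¹ ≤ 1 := inv_le_one_of_one_le₀ hC1
  calc ∫⁻ x, ENNReal.ofReal (Real.exp ((C * (β / θ) ^ n * c)⁻¹ *
          |(subgradientFun Q β α u v)^[n] f x|)) ∂μ
      ≤ ∫⁻ x, (ENNReal.ofReal C⁻¹ * ENNReal.ofReal (Real.exp (c⁻¹ * ((β / θ) ^ n)⁻¹ *
          |(subgradientFun Q β α u v)^[n] f x|)) + ENNReal.ofReal (1 - C⁻¹)) ∂μ := by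
        refine lintegral_mono fun x => ?_
        rw [← ENNReal.ofReal_mul hinv0, ← ENNReal.ofReal_add (by positivity) (sub_nonneg.2 hinv1)]
        refine ENNReal.ofReal_le_ofReal (le_trans (le_of_eq ?_) ((exp_convex_comb_le hinv0 hinv1
          (c⁻¹ * ((β / θ) ^ n)⁻¹ * |(subgradientFun Q β α u v)^[n] f x|) 0).trans
            (by rw [Real.exp_zero, mul_one])))
        congr 1
        rw [mul_inv, mul_inv]
        ring
    _ ≤ ENNReal.ofReal C⁻¹ * (2 + K) + ENNReal.ofReal (1 - C⁻¹) := by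
        rw [lintegral_add_left (by fun_prop), lintegral_const_mul _ (by fun_prop)]
        simp only [lintegral_const, measure_univ, mul_one]
        gcongr
    _ = 2 := by
        rw [← ENNReal.ofReal_toReal hKtop.ne, ← ENNReal.ofReal_ofNat 2,
          ← ENNReal.ofReal_add zero_le_two ENNReal.toReal_nonneg, ← ENNReal.ofReal_mul hinv0,
          ← ENNReal.ofReal_add (by positivity) (sub_nonneg.2 hinv1)]
        congr 1
        have : K.toReal = C - 1 := by simp [C]
        rw [this]
        field_simp
        ring

end Subgradient

/-! ### Orlicz hearts and stability -/

section Stability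

variable {𝒳 : Type*} [MeasurableSpace 𝒳] {μ : Measure 𝒳} [IsProbabilityMeasure μ]

theorem mem_orliczHeart_one_iff (f : 𝒳 →ₘ[μ] ℝ) :
    f ∈ OrliczHeart μ 1 le_rfl ↔ HasExpMoments μ f := by
  have hm := f.stronglyMeasurable.measurable
  constructor
  · intro h
    have h2 : HasExpMoments μ (fun x => |f x|) :=
      hasExpMoments_of_nonneg (by fun_prop) (by simp) (c₀ := 1) fun c hc => by
        have := h c⁻¹ (by positivity)
        rwa [expMoment_one_eq (by positivity), inv_inv] at this
    exact h2.of_abs_le hm (by simp)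
  · intro h c hc
    rw [expMoment_one_eq hc]
    exact lintegral_exp_lt_top (h.abs hm _)

/-- For `t ≥ 0` and `s ≤ r` one has `t ^ s ≤ 1 + t ^ r`. -/
theorem orliczHeart_mono {s r : ℝ} (hs : 1 ≤ s) (hr : 1 ≤ r) (hsr : s ≤ r) :
    OrliczHeart μ r hr ≤ OrliczHeart μ s hs := by
  intro f hf c hc
  refine lt_of_le_of_lt (b := ENNReal.ofReal (Real.exp 1) * expMoment μ r c f) ?_
    (ENNReal.mul_lt_top ENNReal.ofReal_lt_top (hf c hc))
  unfold expMoment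
  rw [← lintegral_const_mul'' _ (aemeasurable_expMoment r c f)]
  refine lintegral_mono fun x => ?_
  rw [← ENNReal.ofReal_mul (Real.exp_pos _).le, ← Real.exp_add]
  refine ENNReal.ofReal_le_ofReal (Real.exp_le_exp.2 ?_)
  rcases le_total |f x / c| 1 with h | h
  · exact (Real.rpow_le_one (abs_nonneg _) h (by linarith)).trans
      (le_add_of_nonneg_right (by positivity))
  · exact (Real.rpow_le_rpow_of_exponent_le h hsr).trans (le_add_of_nonneg_left zero_le_one)

/-- The limit `lim ‖D ^ n‖ ^ (1 / n)` exists, and is at most `γ` if `‖D ^ n‖ ≤ C γ ^ n`. -/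
theorem exists_tendsto_norm_pow_rpow {E : Type*} [NormedAddCommGroup E] [NormedSpace ℝ E]
    (D : E →L[ℝ] E) {C γ : ℝ} (hC : 0 < C) (hγ : 0 < γ) (h : ∀ n : ℕ, ‖D ^ n‖ ≤ C * γ ^ n) :
    ∃ ρ : ℝ, ρ ≤ γ ∧ Tendsto (fun n : ℕ => ‖D ^ n‖ ^ (1 / (n : ℝ))) atTop (𝓝 ρ) := by
  -- Existence of the limit comes from submultiplicativity, used for a seminorm on a commutative
  -- ring: the operator norm is pulled back to polynomials in `D`.
  let p : RingSeminorm (Polynomial ℝ) :=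
    { toFun := fun q => ‖Polynomial.aeval D q‖
      map_zero' := by simp
      add_le' := fun a b => by rw [map_add]; exact norm_add_le _ _
      neg' := fun a => by rw [map_neg, norm_neg]
      mul_le' := fun a b => by rw [map_mul]; exact norm_mul_le _ _ }
  have hp : ∀ n : ℕ, p (Polynomial.X ^ n) = ‖D ^ n‖ := fun n => by
    change ‖Polynomial.aeval D (Polynomial.X ^ n)‖ = _
    simp
  -- Only an inequality, since the identity of a trivial space has norm zero.
  have hp1 : p 1 ≤ 1 := by
    change ‖Polynomial.aeval D 1‖ ≤ 1
    rw [map_one]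
    exact ContinuousLinearMap.norm_id_le
  have hlim := tendsto_smoothingFun_of_map_one_le_one p hp1 Polynomial.X
  replace hlim : Tendsto (fun n : ℕ => ‖D ^ n‖ ^ (1 / (n : ℝ))) atTop
      (𝓝 (smoothingFun p Polynomial.X)) := hlim.congr fun n => by rw [← hp]
  refine ⟨_, ?_, hlim⟩
  have hlim2 : Tendsto (fun n : ℕ => C ^ (1 / (n : ℝ)) * γ) atTop (𝓝 (C ^ (0 : ℝ) * γ)) :=
    ((Real.continuousAt_const_rpow hC.ne').tendsto.comp
      tendsto_one_div_atTop_nhds_zero_nat).mul_const γ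
  rw [Real.rpow_zero, one_mul] at hlim2
  refine le_of_tendsto_of_tendsto hlim hlim2 ?_
  filter_upwards [eventually_gt_atTop 0] with n hn
  refine (Real.rpow_le_rpow (norm_nonneg _) (h n) (by positivity)).trans (le_of_eq ?_)
  rw [Real.mul_rpow hC.le (by positivity), ← Real.rpow_natCast, ← Real.rpow_mul hγ.le,
    mul_one_div_cancel (by positivity), Real.rpow_one]

theorem luxemburgNorm_le_mul {r : ℝ} {hr : 1 ≤ r} {k : ℝ} (hk : 0 < k) (f g : OrliczHeart μ r hr)
    (h : ∀ c : ℝ, 0 < c → expMoment μ r c (f : 𝒳 →ₘ[μ] ℝ) ≤ 2 →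
      expMoment μ r (k * c) (g : 𝒳 →ₘ[μ] ℝ) ≤ 2) : ‖g‖ ≤ k * ‖f‖ := by
  rw [← div_le_iff₀' hk]
  refine le_csInf (luxemburg_nonempty f) fun c hc => ?_
  rw [div_le_iff₀' hk]
  exact csInf_le (luxemburg_bddBelow μ r _) ⟨mul_pos hk hc.1, h c hc.1 hc.2⟩

variable {Q : Kernel 𝒳 𝒳} [IsMarkovKernel Q] {β α : ℝ} {u : 𝒳 → 𝒳 → ℝ}

/-- Every fixed point of the recursion with finite exponential moments is stable. -/
theorem stableIn_one_of_fixedPoint (hβ0 : 0 < β) (hβ1 : β < 1) (hQ : Q.Invariant μ)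
    (hu : Measurable (Function.uncurry u)) (hum : HasExpMoments (μ ⊗ₘ Q) (Function.uncurry u))
    {v : 𝒳 →ₘ[μ] ℝ} (hvm : HasExpMoments μ v) (hTv : recursionFun Q β α u v =ᵐ[μ] v) :
    StableIn μ Q β α u hu 1 le_rfl v := by
  have hv := v.stronglyMeasurable.measurable
  have hmeas : ∀ f : 𝒳 →ₘ[μ] ℝ, Measurable f := fun f => f.stronglyMeasurable.measurable
  have hop : ∀ f : 𝒳 →ₘ[μ] ℝ, subgradientOp μ Q β α u hu v f =ᵐ[μ] subgradientFun Q β α u v f :=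
    fun f => AEEqFun.coeFn_mk _ _
  have hmem : ∀ f : OrliczHeart μ 1 le_rfl, HasExpMoments μ (f : 𝒳 →ₘ[μ] ℝ) :=
    fun f => (mem_orliczHeart_one_iff _).1 f.2
  have hint : ∀ f : OrliczHeart μ 1 le_rfl, ∀ᵐ x ∂μ, Integrable
      (fun y => changeOfMeasure Q α u v x y * (f : 𝒳 →ₘ[μ] ℝ) y) (Q x) := fun f =>
    ae_integrable_changeOfMeasure_mul hβ0 hQ hu hum hv hvm hTv (hmeas _) (hmem f)
  -- Any `θ` strictly between `β` and `1` makes the geometric rate `β / θ` less than one.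
  obtain ⟨θ, hβθ, hθ1⟩ := exists_between hβ1
  have hθ0 : 0 < θ := hβ0.trans hβθ
  obtain ⟨C, hC, hCb⟩ := exists_expMoment_iterate_subgradientFun_le hβ0 hQ hu hum hv hvm hTv
    hθ0 hθ1
  have hγ0 : 0 < β / θ := by positivity
  have hγ1 : β / θ < 1 := (div_lt_one hθ0).2 hβθ
  let L : OrliczHeart μ 1 le_rfl →ₗ[ℝ] OrliczHeart μ 1 le_rfl :=
    { toFun := fun f => ⟨subgradientOp μ Q β α u hu v f, (mem_orliczHeart_one_iff _).2
        ((hasExpMoments_subgradientFun hβ0 hQ hu hum hv hvm hTv (hmeas _) (hmem f)).congr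
          (hop f).symm)⟩
      map_add' := fun f g => by
        refine Subtype.ext (AEEqFun.ext ?_)
        refine (hop _).trans ((subgradientFun_congr_ae hQ (AEEqFun.coeFn_add _ _)).trans ?_)
        refine EventuallyEq.trans ?_ (AEEqFun.coeFn_add _ _).symm
        filter_upwards [hop f, hop g, hint f, hint g] with x h1 h2 h3 h4
        rw [Pi.add_apply, h1, h2]
        simp only [subgradientFun, Pi.add_apply, mul_add]
        rw [integral_add h3 h4, mul_add]
      map_smul' := fun k f => by
        refine Subtype.ext (AEEqFun.ext ?_)
        refine (hop _).trans ((subgradientFun_congr_ae hQ (AEEqFun.coeFn_smul _ _)).trans ?_)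
        refine EventuallyEq.trans ?_ (AEEqFun.coeFn_smul _ _).symm
        filter_upwards [hop f] with x h1
        rw [Pi.smul_apply, h1]
        simp only [subgradientFun, Pi.smul_apply, smul_eq_mul, mul_left_comm _ k]
        rw [integral_const_mul, mul_left_comm, RingHom.id_apply] }
  have hpow : ∀ (n : ℕ) (f : OrliczHeart μ 1 le_rfl),
      (((L ^ n) f : OrliczHeart μ 1 le_rfl) : 𝒳 →ₘ[μ] ℝ) =ᵐ[μ]
        (subgradientFun Q β α u v)^[n] (f : 𝒳 →ₘ[μ] ℝ) := by
    intro n f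
    induction n with
    | zero => simp
    | succ n ih =>
      rw [pow_succ', Module.End.mul_apply, Function.iterate_succ_apply']
      exact (hop _).trans (subgradientFun_congr_ae hQ ih)
  have hbound : ∀ (n : ℕ) (f : OrliczHeart μ 1 le_rfl),
      ‖(L ^ n) f‖ ≤ C * (β / θ) ^ n * ‖f‖ := fun n f =>
    luxemburgNorm_le_mul (by positivity) _ _ fun c hc hle => by
      rw [expMoment_congr (hpow n f)]
      exact hCb n _ (hmeas _) (hmem f) c hc hle
  let D : OrliczHeart μ 1 le_rfl →L[ℝ] OrliczHeart μ 1 le_rfl :=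
    L.mkContinuous (C * (β / θ) ^ 1) fun f => by simpa only [pow_one] using hbound 1 f
  have hD : ∀ (n : ℕ) (f : OrliczHeart μ 1 le_rfl), (D ^ n) f = (L ^ n) f := by
    intro n f
    induction n with
    | zero => rfl
    | succ n ih =>
      rw [pow_succ', pow_succ', mul_apply_eq_comp, Module.End.mul_apply, ih]
      rfl
  refine ⟨D, fun f => rfl, ?_⟩
  obtain ⟨ρ, hρ, hlim⟩ := exists_tendsto_norm_pow_rpow D hC hγ0 fun n =>
    ContinuousLinearMap.opNorm_le_bound _ (by positivity) fun f => by
      rw [hD]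
      exact hbound n f
  exact ⟨ρ, hρ.trans_lt hγ1, hlim⟩

end Stability

/-! ### Existence of a fixed point -/

section Existence

theorem hasExpMoments_of_rpow {Ω : Type*} [MeasurableSpace Ω] {ν : Measure Ω} [IsFiniteMeasure ν]
    {f : Ω → ℝ} (hm : Measurable f) (h0 : ∀ x, 0 ≤ f x) {r : ℝ} (hr : 1 ≤ r)
    (h : ∀ c : ℝ, 0 < c → ∫⁻ x, ENNReal.ofReal (Real.exp (c * f x ^ r)) ∂ν < ⊤) :
    HasExpMoments ν f := by
  refine hasExpMoments_of_nonneg hm (ae_of_all _ h0) (c₀ := 1) fun c hc => ?_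
  refine lt_of_le_of_lt (b := ENNReal.ofReal (Real.exp c) *
    ∫⁻ x, ENNReal.ofReal (Real.exp (c * f x ^ r)) ∂ν) ?_
    (ENNReal.mul_lt_top ENNReal.ofReal_lt_top (h c (by linarith)))
  rw [← lintegral_const_mul _ (by fun_prop)]
  refine lintegral_mono fun x => ?_
  rw [← ENNReal.ofReal_mul (Real.exp_pos _).le, ← Real.exp_add, ← mul_one_add]
  refine ENNReal.ofReal_le_ofReal (Real.exp_le_exp.2 ?_)
  refine mul_le_mul_of_nonneg_left ?_ (by linarith)
  rcases le_total (f x) 1 with h | h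
  · linarith [Real.rpow_nonneg (h0 x) r]
  · linarith [Real.self_le_rpow_of_one_le h hr]

variable {𝒳 : Type*} [MeasurableSpace 𝒳] {μ : Measure 𝒳} [IsProbabilityMeasure μ]
  {Q : Kernel 𝒳 𝒳} [IsMarkovKernel Q] {β α : ℝ} {u : 𝒳 → 𝒳 → ℝ} {f g : 𝒳 → ℝ}

/-- No integrability is needed: otherwise the integral is `0` by convention and `log 0 = 0`. This
keeps the iterates of `U` from `0` nonnegative at every point. -/
theorem log_integral_exp_nonneg {Ω : Type*} [MeasurableSpace Ω] {ν : Measure Ω}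
    [IsProbabilityMeasure ν] {b : Ω → ℝ} (hb : ∀ y, 0 ≤ b y) :
    0 ≤ Real.log (∫ y, Real.exp (b y) ∂ν) := by
  by_cases hi : Integrable (fun y => Real.exp (b y)) ν
  · refine Real.log_nonneg ?_
    have := integral_mono (μ := ν) (integrable_const 1) hi fun y => Real.one_le_exp (hb y)
    simpa using this
  · rw [integral_undef hi, Real.log_zero]

theorem iterate_recursionFun_nonneg (hβ : 0 ≤ β) (n : ℕ) (x : 𝒳) :
    0 ≤ (recursionFun Q β 1 (fun x y => |α * u x y|))^[n] (fun _ => 0) x := by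
  induction n generalizing x with
  | zero => exact le_rfl
  | succ n ih =>
    rw [Function.iterate_succ_apply']
    exact mul_nonneg hβ (log_integral_exp_nonneg fun y => add_nonneg (ih y) (by positivity))

theorem convex_comb_rpow_le {r θ : ℝ} (hr : 1 ≤ r) (h0 : 0 < θ) (h1 : θ < 1) {a b : ℝ}
    (ha : 0 ≤ a) (hb : 0 ≤ b) :
    (a + b) ^ r ≤ θ * (a / θ) ^ r + (1 - θ) * (b / (1 - θ)) ^ r := by
  have h1' : 0 < 1 - θ := sub_pos.2 h1
  have h := (convexOn_rpow hr).2 (Set.mem_Ici.2 (div_nonneg ha h0.le))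
    (Set.mem_Ici.2 (div_nonneg hb h1'.le)) h0.le h1'.le (by ring)
  simpa [mul_div_cancel₀ _ h0.ne', mul_div_cancel₀ _ h1'.ne'] using h

/-- The recursion with nonnegative rewards contracts large moments `E exp (c f ^ r)` up to a
constant. -/
theorem lintegral_exp_rpow_recursionFun_le (hβ0 : 0 < β) (hβ1 : β < 1) (hQ : Q.Invariant μ)
    (hu : Measurable (Function.uncurry u)) (hum : HasExpMoments (μ ⊗ₘ Q) (Function.uncurry u))
    (hf : Measurable f) (hfm : HasExpMoments μ f) (hf0 : ∀ x, 0 ≤ f x) {r : ℝ} (hr : 1 ≤ r)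
    {c : ℝ} (hc : 1 ≤ c * β ^ r) :
    ∫⁻ x, ENNReal.ofReal
        (Real.exp (c * recursionFun Q β 1 (fun x y => |α * u x y|) f x ^ r)) ∂μ ≤
      ENNReal.ofReal β * ∫⁻ x, ENNReal.ofReal (Real.exp (c * f x ^ r)) ∂μ +
        ENNReal.ofReal (1 - β) * ∫⁻ p, ENNReal.ofReal
          (Real.exp (c * β ^ r * ((|α * u p.1 p.2| + 1) / (1 - β)) ^ r)) ∂(μ ⊗ₘ Q) := by
  have hβ' : 0 < 1 - β := by linarith
  have hu' := measurable_abs_reward hu α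
  have hu2 : Measurable fun p : 𝒳 × 𝒳 => |α * u p.1 p.2| := hu'
  have hm := measurable_add_reward hu' hf 1
  refine lintegral_exp_le_of_ae_le hQ
    (F := fun p => c * β ^ r * (f p.2 + 1 * |α * u p.1 p.2| + 1) ^ r)
    (by fun_prop) (by fun_prop) (by fun_prop) hβ0.le hβ1.le ?_ fun p => ?_
  · filter_upwards [ae_hasExpMoments_add_reward hQ hu' (hasExpMoments_abs_reward hu hum α) hfm hf 1]
      with x hx
    have hb : ∀ y, 0 ≤ f y + 1 * |α * u x y| := fun y => add_nonneg (hf0 y) (by positivity)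
    have hs0 := log_integral_exp_nonneg (ν := Q x) hb
    set s := Real.log (∫ y, Real.exp (f y + 1 * |α * u x y|) ∂(Q x)) with hs
    -- The shift in `(t + 1) ^ r` is there for this bound: the slope of `t ^ r` itself may drop
    -- below one near `t = 0`.
    have hslope : 1 ≤ r * (s + 1) ^ (r - 1) :=
      one_le_mul_of_one_le_of_one_le hr (Real.one_le_rpow (by linarith) (by linarith))
    have h := ofReal_exp_log_integral_le (ν := Q x) (fun t => c * β ^ r * (t + 1) ^ r)
      (by fun_prop) (measurable_add_reward_right hu' hf 1 x) hx.integrable_exp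
      (m := c * β ^ r * (r * (s + 1) ^ (r - 1)))
      (one_le_mul_of_one_le_of_one_le hc hslope) (fun y => by
        have h := mul_le_mul_of_nonneg_left (rpow_supporting_line hr
          (by linarith : 0 < s + 1) (by linarith [hb y] : 0 ≤ f y + 1 * |α * u x y| + 1))
          (by linarith : 0 ≤ c * β ^ r)
        refine le_trans (le_of_eq ?_) h
        rw [← hs]
        ring)
    refine le_trans (ENNReal.ofReal_le_ofReal (Real.exp_le_exp.2 ?_)) h
    rw [recursionFun, ← hs, Real.mul_rpow hβ0.le hs0, ← mul_assoc]
    exact mul_le_mul_of_nonneg_left (Real.rpow_le_rpow hs0 (by linarith) (by linarith))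
      (by linarith)
  · have h := mul_le_mul_of_nonneg_left (convex_comb_rpow_le hr hβ0 hβ1 (hf0 p.2)
      (by positivity : 0 ≤ |α * u p.1 p.2| + 1)) (by linarith : 0 ≤ c * β ^ r)
    rw [one_mul, add_assoc]
    refine h.trans (le_of_eq ?_)
    rw [Real.div_rpow (hf0 _) hβ0.le]
    field_simp

/-- A dominating fixed point of the recursion with rewards `|α u|`. -/
theorem exists_nonneg_fixedPoint_abs_reward (hβ0 : 0 < β) (hβ1 : β < 1) (hQ : Q.Invariant μ)
    (hu : Measurable (Function.uncurry u)) (hum : HasExpMoments (μ ⊗ₘ Q) (Function.uncurry u))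
    {r : ℝ} (hr : 1 ≤ r)
    (hK : ∀ c : ℝ, 0 < c → ∫⁻ p, ENNReal.ofReal
      (Real.exp (c * ((|α * u p.1 p.2| + 1) / (1 - β)) ^ r)) ∂(μ ⊗ₘ Q) < ⊤) :
    ∃ h : 𝒳 → ℝ, Measurable h ∧ (∀ x, 0 ≤ h x) ∧
      (∀ c : ℝ, 0 < c → ∫⁻ x, ENNReal.ofReal (Real.exp (c * h x ^ r)) ∂μ < ⊤) ∧
      recursionFun Q β 1 (fun x y => |α * u x y|) h =ᵐ[μ] h := by
  have hu' := measurable_abs_reward hu α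
  have hum' := hasExpMoments_abs_reward hu hum α
  set U := recursionFun Q β 1 (fun x y => |α * u x y|) with hU
  set a : ℕ → 𝒳 → ℝ := fun n => U^[n] (fun _ => 0) with ha
  have ha_succ : ∀ n, a (n + 1) = U (a n) := fun n => Function.iterate_succ_apply' U n _
  have ha_meas : ∀ n, Measurable (a n) := measurable_iterate_recursionFun hu' measurable_const
  have ha_exp : ∀ n, HasExpMoments μ (a n) :=
    hasExpMoments_iterate_recursionFun hβ0 hβ1 hQ hu' hum' measurable_const
      (fun c => integrable_const _)
  have ha0 : ∀ n x, 0 ≤ a n x := fun n x => iterate_recursionFun_nonneg hβ0.le n x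
  have hmono : ∀ n, ∀ᵐ x ∂μ, a n x ≤ a (n + 1) x := by
    intro n
    induction n with
    | zero => exact ae_of_all _ fun x => ha0 1 x
    | succ n ih =>
      rw [ha_succ n, ha_succ (n + 1)]
      exact ae_recursionFun_le hβ0.le hQ hu' hum' (ha_meas n) (ha_meas (n + 1)) (ha_exp (n + 1)) ih
  have hmono' : ∀ᵐ x ∂μ, Monotone fun n => a n x := by
    filter_upwards [ae_all_iff.2 hmono] with x hx
    exact monotone_nat_of_le_succ hx
  have hsup : ∀ c : ℝ, 1 ≤ c * β ^ r →
      ∫⁻ x, ⨆ n, ENNReal.ofReal (Real.exp (c * a n x ^ r)) ∂μ < ⊤ := by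
    intro c hc
    have hβr : 0 < β ^ r := by positivity
    have hc0 : 0 < c := pos_of_mul_pos_left (by linarith) hβr.le
    set K := ∫⁻ p, ENNReal.ofReal
      (Real.exp (c * β ^ r * ((|α * u p.1 p.2| + 1) / (1 - β)) ^ r)) ∂(μ ⊗ₘ Q)
    have hKtop : K < ⊤ := hK _ (by positivity)
    -- Monotone convergence reduces the moment of the supremum to the uniform bound `1 + K`; the `1`
    -- is the moment of the zero starting function.
    rw [lintegral_iSup' (fun n => (by have := ha_meas n; fun_prop)) ?_]
    · refine lt_of_le_of_lt (iSup_le fun n => ?_) (ENNReal.add_lt_top.2 ⟨ENNReal.one_lt_top, hKtop⟩)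
      refine (affine_iterate_le (M := 1) (K := K) (a := fun n =>
        ∫⁻ x, ENNReal.ofReal (Real.exp (c * a n x ^ r)) ∂μ) hβ0.le hβ1.le ?_ (fun n => ?_)
        n).trans ?_
      · simp [ha, Real.zero_rpow (by linarith : r ≠ 0)]
      · simp only [ha_succ]
        exact lintegral_exp_rpow_recursionFun_le hβ0 hβ1 hQ hu hum (ha_meas n) (ha_exp n) (ha0 n)
          hr hc
      · rw [mul_one]
        gcongr
        exact pow_le_one₀ bot_le (by simpa using hβ1.le)
    · filter_upwards [hmono'] with x hx n m hnm
      exact ENNReal.ofReal_le_ofReal (Real.exp_le_exp.2 (mul_le_mul_of_nonneg_left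
        (Real.rpow_le_rpow (ha0 n x) (hx hnm) (by linarith)) hc0.le))
  set h : 𝒳 → ℝ := fun x => ⨆ n, a n x with hh
  have hh_meas : Measurable h := Measurable.iSup ha_meas
  -- Where the iterates are unbounded the real supremum is `0` by convention, so nonnegativity holds
  -- everywhere; boundedness is then shown almost everywhere.
  have hh0 : ∀ x, 0 ≤ h x := fun x => Real.iSup_nonneg fun n => ha0 n x
  have hβr : 0 < β ^ r := by positivity
  have hbdd : ∀ᵐ x ∂μ, BddAbove (Set.range fun n => a n x) := by
    have hc : 1 ≤ (β ^ r)⁻¹ * β ^ r := by rw [inv_mul_cancel₀ hβr.ne']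
    have hc1 : 1 ≤ (β ^ r)⁻¹ :=
      (one_le_inv₀ hβr).2 (Real.rpow_le_one hβ0.le hβ1.le (by linarith))
    have hfin := ae_lt_top' (AEMeasurable.iSup fun n => by have := ha_meas n; fun_prop)
      (hsup _ hc).ne
    filter_upwards [hfin] with x hx
    refine ⟨1 + (⨆ n, ENNReal.ofReal (Real.exp ((β ^ r)⁻¹ * a n x ^ r))).toReal, ?_⟩
    rintro _ ⟨n, rfl⟩
    have h1 : Real.exp ((β ^ r)⁻¹ * a n x ^ r) ≤
        (⨆ n, ENNReal.ofReal (Real.exp ((β ^ r)⁻¹ * a n x ^ r))).toReal := by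
      rw [← ENNReal.ofReal_le_iff_le_toReal hx.ne]
      exact le_iSup (fun n => ENNReal.ofReal (Real.exp ((β ^ r)⁻¹ * a n x ^ r))) n
    have h2 := Real.add_one_le_exp ((β ^ r)⁻¹ * a n x ^ r)
    have h3 : a n x ^ r ≤ (β ^ r)⁻¹ * a n x ^ r :=
      le_mul_of_one_le_left (Real.rpow_nonneg (ha0 n x) r) hc1
    change a n x ≤ _
    rcases le_total (a n x) 1 with h | h
    · linarith [Real.rpow_nonneg (ha0 n x) r]
    · linarith [Real.self_le_rpow_of_one_le h hr]
  have hlim : ∀ᵐ x ∂μ, Tendsto (fun n => a n x) atTop (𝓝 (h x)) := by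
    filter_upwards [hmono', hbdd] with x h1 h2
    exact tendsto_atTop_ciSup h1 h2
  have hle : ∀ n, ∀ᵐ x ∂μ, |a n x| ≤ h x := fun n => by
    filter_upwards [hbdd] with x hx
    rw [abs_of_nonneg (ha0 n x)]
    exact le_ciSup hx n
  have hlarge : ∀ c : ℝ, 1 ≤ c * β ^ r →
      ∫⁻ x, ENNReal.ofReal (Real.exp (c * h x ^ r)) ∂μ < ⊤ := by
    intro c hc
    refine lt_of_le_of_lt (lintegral_mono_ae ?_) (hsup c hc)
    filter_upwards [hlim] with x hx
    refine le_of_tendsto' ((ENNReal.continuous_ofReal.tendsto _).comp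
      ((Real.continuous_exp.tendsto _).comp
        ((hx.rpow_const (p := r) (Or.inr (by linarith))).const_mul c))) fun n => ?_
    exact le_iSup (fun n => ENNReal.ofReal (Real.exp (c * a n x ^ r))) n
  have hall : ∀ c : ℝ, 0 < c → ∫⁻ x, ENNReal.ofReal (Real.exp (c * h x ^ r)) ∂μ < ⊤ := by
    intro c hc
    refine lt_of_le_of_lt (lintegral_mono fun x => ?_) (hlarge (max c (β ^ r)⁻¹) ?_)
    · exact ENNReal.ofReal_le_ofReal (Real.exp_le_exp.2 (mul_le_mul_of_nonneg_right
        (le_max_left _ _) (Real.rpow_nonneg (hh0 x) r)))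
    · rw [← inv_le_iff_one_le_mul₀ hβr]
      exact le_max_right _ _
  refine ⟨h, hh_meas, hh0, hall, ?_⟩
  have hT := tendsto_recursionFun (β := β) (α := 1) hQ hu' hum' ha_meas hh_meas hh_meas
    (hasExpMoments_of_rpow hh_meas hh0 hr hall) hle hlim
  filter_upwards [hT, hlim] with x h1 h2
  refine tendsto_nhds_unique h1 (((tendsto_add_atTop_iff_nat 1).2 h2).congr fun n => ?_)
  rw [ha_succ]

/-- The recursion has a fixed point between `-h` and `h`. -/
theorem exists_fixedPoint_abs_le (hβ0 : 0 < β) (hβ1 : β < 1) (hQ : Q.Invariant μ)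
    (hu : Measurable (Function.uncurry u)) (hum : HasExpMoments (μ ⊗ₘ Q) (Function.uncurry u))
    {h : 𝒳 → ℝ} (hh : Measurable h) (hhm : HasExpMoments μ h) (h0 : ∀ x, 0 ≤ h x)
    (hfix : recursionFun Q β 1 (fun x y => |α * u x y|) h =ᵐ[μ] h) :
    ∃ v : 𝒳 → ℝ, Measurable v ∧ (∀ᵐ x ∂μ, |v x| ≤ h x) ∧ recursionFun Q β α u v =ᵐ[μ] v := by
  set T := recursionFun Q β α u with hT
  set b : ℕ → 𝒳 → ℝ := fun n => T^[n] h with hb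
  have hb_succ : ∀ n, b (n + 1) = T (b n) := fun n => Function.iterate_succ_apply' T n _
  have hb_meas : ∀ n, Measurable (b n) := measurable_iterate_recursionFun hu hh
  have hb_exp : ∀ n, HasExpMoments μ (b n) :=
    hasExpMoments_iterate_recursionFun hβ0 hβ1 hQ hu hum hh hhm
  have hab : ∀ n, ∀ᵐ x ∂μ, |b n x| ≤ h x := by
    intro n
    induction n with
    | zero => exact ae_of_all _ fun x => (abs_of_nonneg (h0 x)).le
    | succ n ih =>
      rw [hb_succ]
      filter_upwards [ae_abs_recursionFun_le hβ0.le hQ hu hum (hb_meas n) hh hhm ih, hfix]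
        with x h1 h2
      rwa [h2] at h1
  have hanti : ∀ n, ∀ᵐ x ∂μ, b (n + 1) x ≤ b n x := by
    intro n
    induction n with
    -- The first step down is the invariance `|T h| ≤ h`; monotonicity of `T` propagates it.
    | zero => exact (hab 1).mono fun x hx => (le_abs_self _).trans hx
    | succ n ih =>
      have h1 : ∀ᵐ x ∂μ, T (b (n + 1)) x ≤ T (b n) x :=
        ae_recursionFun_le hβ0.le hQ hu hum (hb_meas (n + 1)) (hb_meas n) (hb_exp n) ih
      rwa [← hb_succ, ← hb_succ] at h1
  set v : 𝒳 → ℝ := fun x => ⨅ n, b n x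
  have hv : Measurable v := Measurable.iInf hb_meas
  have hlim : ∀ᵐ x ∂μ, Tendsto (fun n => b n x) atTop (𝓝 (v x)) := by
    filter_upwards [ae_all_iff.2 hanti, ae_all_iff.2 hab] with x h1 h2
    refine tendsto_atTop_ciInf (antitone_nat_of_succ_le h1) ⟨-h x, ?_⟩
    rintro _ ⟨n, rfl⟩
    exact (abs_le.1 (h2 n)).1
  refine ⟨v, hv, ?_, ?_⟩
  · filter_upwards [hlim, ae_all_iff.2 hab] with x h1 h2
    exact le_of_tendsto' h1.abs h2
  · filter_upwards [tendsto_recursionFun (β := β) (α := α) hQ hu hum hb_meas hv hh hhm hab hlim,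
      hlim] with x h1 h2
    refine tendsto_nhds_unique h1 (((tendsto_add_atTop_iff_nat 1).2 h2).congr fun n => ?_)
    rw [hb_succ]

/-- Based on `|α w| + 1 ≤ 2 max |α w| 1`, whose `r`-th power is at most a multiple of `|α| ^ r |w| ^
r + 1`; the multiple is absorbed into the scale in `hthin`. -/
theorem lintegral_exp_reward_rpow_lt_top {Ω : Type*} [MeasurableSpace Ω] {ν : Measure Ω}
    {w : Ω → ℝ} {r : ℝ} (hr : 1 ≤ r)
    (hthin : ∀ c : ℝ, 0 < c → ∫⁻ p, ENNReal.ofReal (Real.exp (|w p| ^ r / c)) ∂ν < ⊤)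
    (α : ℝ) {c d : ℝ} (hc : 0 < c) (hd : 0 < d) (hw : Measurable w) :
    ∫⁻ p, ENNReal.ofReal (Real.exp (c * ((|α * w p| + 1) / d) ^ r)) ∂ν < ⊤ := by
  set k : ℝ := c * (2 / d) ^ r with hk
  have hk0 : 0 < k := by positivity
  have hα : 0 < |α| ^ r + 1 := by positivity
  refine lt_of_le_of_lt (b := ENNReal.ofReal (Real.exp k) *
    ∫⁻ p, ENNReal.ofReal (Real.exp (|w p| ^ r / (k * (|α| ^ r + 1))⁻¹)) ∂ν) ?_
    (ENNReal.mul_lt_top ENNReal.ofReal_lt_top (hthin _ (by positivity)))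
  rw [← lintegral_const_mul _ (by fun_prop)]
  refine lintegral_mono fun p => ?_
  rw [← ENNReal.ofReal_mul (Real.exp_pos _).le, ← Real.exp_add]
  refine ENNReal.ofReal_le_ofReal (Real.exp_le_exp.2 ?_)
  have hmax : |α * w p| + 1 ≤ 2 * max |α * w p| 1 := by
    linarith [le_max_left |α * w p| 1, le_max_right |α * w p| 1]
  have hmaxr : max |α * w p| 1 ^ r ≤ |α| ^ r * |w p| ^ r + 1 := by
    rcases max_cases |α * w p| 1 with ⟨e, -⟩ | ⟨e, -⟩ <;> rw [e]
    · rw [abs_mul, Real.mul_rpow (abs_nonneg _) (abs_nonneg _)]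
      linarith
    · rw [Real.one_rpow]
      have : 0 ≤ |α| ^ r * |w p| ^ r := by positivity
      linarith
  calc c * ((|α * w p| + 1) / d) ^ r ≤ c * (2 / d * max |α * w p| 1) ^ r := by
        gcongr
        rw [div_mul_eq_mul_div]
        gcongr
    _ = k * max |α * w p| 1 ^ r := by
        rw [Real.mul_rpow (by positivity) (by positivity), ← mul_assoc]
    _ ≤ k * (|α| ^ r * |w p| ^ r + 1) := by gcongr
    _ ≤ k + |w p| ^ r / (k * (|α| ^ r + 1))⁻¹ := by
        rw [div_inv_eq_mul]
        nlinarith [mul_nonneg hk0.le (Real.rpow_nonneg (abs_nonneg (w p)) r)]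

end Existence

/-! ### Assembling the theorem -/

theorem mem_orliczHeart_of_abs_le {𝒳 : Type*} [MeasurableSpace 𝒳] {μ : Measure 𝒳}
    [IsProbabilityMeasure μ] {r : ℝ} (hr : 1 ≤ r) {h : 𝒳 → ℝ}
    (hh : ∀ c : ℝ, 0 < c → ∫⁻ x, ENNReal.ofReal (Real.exp (c * h x ^ r)) ∂μ < ⊤)
    {v : 𝒳 →ₘ[μ] ℝ} (hv : ∀ᵐ x ∂μ, |v x| ≤ h x) : v ∈ OrliczHeart μ r hr := by
  intro c hc
  refine lt_of_le_of_lt (lintegral_mono_ae ?_) (hh ((c ^ r)⁻¹) (by positivity))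
  filter_upwards [hv] with x hx
  refine ENNReal.ofReal_le_ofReal (Real.exp_le_exp.2 ?_)
  rw [abs_div, abs_of_pos hc, Real.div_rpow (abs_nonneg _) hc.le, div_eq_inv_mul]
  gcongr

end

theorem theorem1 {𝒳 : Type*} [MeasurableSpace 𝒳] (μ : Measure 𝒳) [IsProbabilityMeasure μ]
    (Q : Kernel 𝒳 𝒳) [IsMarkovKernel Q] (hQ : Q.Invariant μ)
    (β : ℝ) (hβ0 : 0 < β) (hβ1 : β < 1) (α : ℝ)
    (u : 𝒳 → 𝒳 → ℝ) (hu : Measurable (Function.uncurry u))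
    (r : ℝ) (hr : 1 ≤ r)
    (hthin : ∀ c : ℝ, 0 < c →
      ∫⁻ p, ENNReal.ofReal (Real.exp (|u p.1 p.2| ^ r / c)) ∂(μ ⊗ₘ Q) < ⊤) :
    ∃ v : 𝒳 →ₘ[μ] ℝ,
      v ∈ fixedPointsIn μ Q β α u hu r hr ∧
      (1 < r →
        (∀ (s : ℝ) (hs : 1 < s), s ≤ r → fixedPointsIn μ Q β α u hu s hs.le = {v}) ∧
        IsLeast (fixedPointsIn μ Q β α u hu 1 le_rfl) v ∧
        {w | w ∈ fixedPointsIn μ Q β α u hu 1 le_rfl ∧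
          StableIn μ Q β α u hu 1 le_rfl w} = {v}) := by
  have hum : HasExpMoments (μ ⊗ₘ Q) (Function.uncurry u) := by
    have h : HasExpMoments (μ ⊗ₘ Q) (fun p => |Function.uncurry u p|) := by
      refine hasExpMoments_of_rpow (by fun_prop) (fun _ => abs_nonneg _) hr fun c hc => ?_
      have := hthin c⁻¹ (by positivity)
      simpa only [div_inv_eq_mul, mul_comm _ c, Function.uncurry] using this
    exact h.of_abs_le hu (by simp)
  obtain ⟨h, hh, hh0, hhr, hhfix⟩ := exists_nonneg_fixedPoint_abs_reward (α := α) hβ0 hβ1 hQ hu hum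
    hr fun c hc => lintegral_exp_reward_rpow_lt_top (w := Function.uncurry u) hr hthin α hc
      (sub_pos.2 hβ1) hu
  have hhm := hasExpMoments_of_rpow hh hh0 hr hhr
  obtain ⟨v, hv, hvh, hTv⟩ := exists_fixedPoint_abs_le hβ0 hβ1 hQ hu hum hh hhm hh0 hhfix
  set V : 𝒳 →ₘ[μ] ℝ := AEEqFun.mk v hv.aestronglyMeasurable with hV
  have hVv : V =ᵐ[μ] v := AEEqFun.coeFn_mk _ _
  have hVr : V ∈ OrliczHeart μ r hr := mem_orliczHeart_of_abs_le hr hhr (by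
    filter_upwards [hVv, hvh] with x h1 h2
    rwa [h1])
  have hVfix : recursionOp μ Q β α u hu V = V :=
    AEEqFun.ext ((recursionOp_mk hQ β α hu v _).trans (hTv.trans hVv.symm))
  have hfun : ∀ w : 𝒳 →ₘ[μ] ℝ, recursionOp μ Q β α u hu w = w → recursionFun Q β α u w =ᵐ[μ] w :=
    fun w hw => (AEEqFun.coeFn_mk _ _).symm.trans (by
      change recursionOp μ Q β α u hu w =ᵐ[μ] w
      rw [hw])
  have hexp : ∀ (s : ℝ) (hs : 1 ≤ s) (w : 𝒳 →ₘ[μ] ℝ), w ∈ OrliczHeart μ s hs →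
      HasExpMoments μ w := fun s hs w hw =>
    (mem_orliczHeart_one_iff w).1 (orliczHeart_mono le_rfl hs hs hw)
  -- Every `E^{φ_s}` lies in `E^{φ_1}`, where the comparison of fixed points works in both
  -- directions. The case `s = 1` yields both minimality and the uniqueness of the stable fixed
  -- point.
  have hset : ∀ (s : ℝ) (hs : 1 ≤ s), s ≤ r → fixedPointsIn μ Q β α u hu s hs = {V} := by
    intro s hs hsr
    refine Set.eq_singleton_iff_unique_mem.2 ⟨⟨orliczHeart_mono hs hr hsr hVr, hVfix⟩, ?_⟩
    rintro w ⟨hw, hwfix⟩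
    have hwm := w.stronglyMeasurable.measurable
    have hVm := V.stronglyMeasurable.measurable
    have h1 := le_of_fixedPoints hβ0 hβ1 hQ hu hum hVm (hexp r hr V hVr) hwm (hexp s hs w hw)
      (hfun V hVfix) (hfun w hwfix)
    have h2 := le_of_fixedPoints hβ0 hβ1 hQ hu hum hwm (hexp s hs w hw) hVm (hexp r hr V hVr)
      (hfun w hwfix) (hfun V hVfix)
    refine AEEqFun.ext ?_
    filter_upwards [h1, h2] with x e1 e2
    exact le_antisymm e1 e2
  refine ⟨V, ⟨hVr, hVfix⟩, fun _ => ⟨fun s hs hsr => hset s hs.le hsr, ?_, ?_⟩⟩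
  · rw [hset 1 le_rfl hr]
    exact isLeast_singleton
  · rw [hset 1 le_rfl hr]
    refine Set.eq_singleton_iff_unique_mem.2 ⟨⟨rfl, ?_⟩, fun w hw => hw.1⟩
    exact stableIn_one_of_fixedPoint hβ0 hβ1 hQ hu hum (hexp r hr V hVr) (hfun V hVfix)
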